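/- Let $\mathcal X\subset\mathbb R^d$ be compact and let $s_1,\dots,s_k\in\mathcal X$. Let $X_1,X_2,\dots$ be independent copies of a real stochastic process $X=\{X(t)\colon t\in\mathcal X\}$ with continuous one-dimensional marginal distribution functions. Put $M_n(t)=\max_{1\le i\le n}X_i(t)$ and $C_i=\{j\colon M_n(s_j)=X_i(s_j)\}$, $1\le i\le n$. The sample hitting scenario $\pi_n$ is the partition of $\{1,\dots,k\}$ in which $j_1,j_2$ lie in the same block if and only if $\operatorname{arg\,max}_{1\le i\le n}X_i(s_{j_1})=\operatorname{arg\,max}_{1\le i\le n}X_i(s_{j_2})$ (equality of sets), and the sample concurrence probability is $$p_n=\mathbb P\bigl[\text{for some }\ell\in\{1,\dots,n\}\colon M_n(s_j)=X_\ell(s_j),\ j=1,\dots,k\bigr].$$ Let $\{\zeta_i\colon i\ge1\}$ be the points of a Poisson process on $(0,\infty)$ with intensity $\zeta^{-2}\,d\zeta$ and, independently of it, let $Y_1,Y_2,\dots$ be independent copies of a nonnegative process $Y$ on $\mathcal X$ with continuous sample paths, $\mathbb E\,Y(t)=1$ for all $t\in\mathcal X$ and $\mathbb E\sup_{t\in\mathcal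 X}Y(t)<\infty$. Put $\varphi_i=\zeta_iY_i$ and let $\eta(t)=\max_{i\ge1}\varphi_i(t)$ be the associated max-stable process. The extremal hitting scenario $\pi$ is the random partition of $\{1,\dots,k\}$ in which $j_1,j_2$ lie in the same block if and only if $\operatorname{arg\,max}_{i\ge1}\varphi_i(s_{j_1})=\operatorname{arg\,max}_{i\ge1}\varphi_i(s_{j_2})$, and the extremal concurrence probability is $$p=\mathbb P\bigl[\text{for some }\ell\ge1\colon \eta(s_j)=\varphi_\ell(s_j),\ j=1,\dots,k\bigr].$$ Suppose that for some deterministic functions $h_1,\dots,h_k$, where $h_j$ is real-valued and strictly increasing on a Borel set $D_j\subset\mathbb R$ with $\mathbb P[X(s_j)\in D_j]=1$, the vector $(h_1\{X(s_1)\},\dots,h_k\{X(s_k)\})$ belongs to the max-domain of attraction of $(\eta(s_1),\dots,\eta(s_k))$; that is, there are $a_n\in(0,\infty)^k$ and $b_n\in\mathbb R^k$ such that the componentwise maxima of its first $n$ independent copies $(h_1\{X_i(s_1)\},\dots,h_k\{X_i(s_k)\})$, $1\le i\le n$, after componentwise centring by $b_n$ and division by $a_n$, converge in distribution to $(\eta(s_1),\dots,\eta(s_k))$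 as $n\to\infty$. Then: 1. for every $n\ge1$, almost surely $\pi_n=\{C_i\colon 1\le i\le n,\ C_i\ne\emptyset\}$; and almost surely, for every $j$, the maximum $\eta(s_j)=\max_{i\ge1}\varphi_i(s_j)$ is attained at exactly one $i$; 2. $\pi_n$ converges weakly to $\pi$ as $n\to\infty$, as random elements of the finite set of partitions of $\{1,\dots,k\}$; 3. in particular $p_n\to p$ as $n\to\infty$. -/

import Mathlib

open MeasureTheory ProbabilityTheory Filter Topology Set

namespace Concurrence

noncomputable section

/-- `X 0, X 1, …` are independent copies of one real stochastic process indexed by `T`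
(a process is a random element of `T → ℝ` with the product σ-algebra). -/
structure IndepCopies {Ω T : Type*} [MeasurableSpace Ω]
    (X : ℕ → Ω → T → ℝ) (P : Measure Ω) : Prop where
  measurable : ∀ i t, Measurable fun ω => X i ω t
  indep : iIndepFun X P
  identDistrib : ∀ i, IdentDistrib (X i) (X 0) P P

/-- Number of points of the sequence `ξ` that lie in `A`, counted with multiplicity. -/
def pointCount {Ω E : Type*} (ξ : ℕ → Ω → E) (A : Set E) (ω : Ω) : ℕ∞ :=
  {i : ℕ | ξ i ω ∈ A}.encard

/-- The random points `ξ 0, ξ 1, …` (in any measurable enumeration) are the points of a Poisson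
process with intensity measure `μ`: numbers of points in sets of finite intensity are Poisson
distributed, and numbers of points in disjoint sets are independent. -/
structure IsPoissonProcess {Ω E : Type*} [MeasurableSpace Ω] [MeasurableSpace E]
    (ξ : ℕ → Ω → E) (μ : Measure E) (P : Measure Ω) : Prop where
  measurable : ∀ i, Measurable (ξ i)
  law_count : ∀ A, MeasurableSet A → μ A ≠ ⊤ →
    HasLaw (pointCount ξ A) ((poissonMeasure (μ A).toNNReal).map ((↑) : ℕ → ℕ∞)) P
  indep_count : ∀ (m : ℕ) (A : Fin m → Set E), (∀ l, MeasurableSet (A l)) →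
    Pairwise (fun l l' => Disjoint (A l) (A l')) → iIndepFun (fun l => pointCount ξ (A l)) P

/-- The measure `z⁻² dz` on `(0, ∞)`. -/
def invSqIntensity : Measure ℝ :=
  (volume.restrict (Ioi 0)).withDensity fun z => ENNReal.ofReal (1 / z ^ 2)

/-- Ingredients of the spectral representation `η(t) = max_i ζ_i Y_i(t)` of a simple max-stable
process: `ζ` are the points of a Poisson process on `(0, ∞)` with intensity `z⁻² dz`, and,
independently of it, the `Y i` are independent copies of a nonnegative process with continuous
sample paths, `E[Y(t)] = 1` for all `t` and `E[sup_t Y(t)] < ∞`. -/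
structure IsSpectralRepresentation {Ω T : Type*} [MeasurableSpace Ω] [TopologicalSpace T]
    (ζ : ℕ → Ω → ℝ) (Y : ℕ → Ω → T → ℝ) (P : Measure Ω) : Prop where
  poisson : IsPoissonProcess ζ invSqIntensity P
  copies : IndepCopies Y P
  indep : IndepFun (fun ω i => ζ i ω) (fun ω i => Y i ω) P
  nonneg : ∀ i ω t, 0 ≤ Y i ω t
  continuous : ∀ i ω, Continuous (Y i ω)
  mean_eq_one : ∀ t, ∫ ω, Y 0 ω t ∂P = 1
  sup_integrable : ∫⁻ ω, ⨆ t, ENNReal.ofReal (Y 0 ω t) ∂P < ⊤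

/-- The points `φ_i = ζ_i Y_i` of the Poisson process on the space of functions. -/
def spectralPoint {Ω T : Type*} (ζ : ℕ → Ω → ℝ) (Y : ℕ → Ω → T → ℝ)
    (i : ℕ) (ω : Ω) (t : T) : ℝ :=
  ζ i ω * Y i ω t

/-- The max-stable process `η(t) = max_i ζ_i Y_i(t)`. -/
def maxStable {Ω T : Type*} (ζ : ℕ → Ω → ℝ) (Y : ℕ → Ω → T → ℝ) (ω : Ω) (t : T) : ℝ :=
  ⨆ i, spectralPoint ζ Y i ω t

/-- Componentwise maximum of the first `n` terms of `Z` (used for `n ≥ 1`). -/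
def sampleMax {Ω T : Type*} (Z : ℕ → Ω → T → ℝ) (n : ℕ) (ω : Ω) (t : T) : ℝ :=
  ⨆ i : Fin n, Z i ω t

/-- The common law of the independent random vectors `Z 0, Z 1, …` belongs to the max-domain of
attraction of the law of `G`: for suitable deterministic `a n j > 0` and `b n j`, the normalized
componentwise maxima `(M_n - b_n) / a_n` converge in distribution to `G`. -/
def InMaxDomainOfAttraction {Ω Ω' : Type*} [MeasurableSpace Ω] [MeasurableSpace Ω'] {k : ℕ}
    (Z : ℕ → Ω → Fin k → ℝ) (P : Measure Ω) [IsProbabilityMeasure P]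
    (G : Ω' → Fin k → ℝ) (P' : Measure Ω') [IsProbabilityMeasure P'] : Prop :=
  ∃ a b : ℕ → Fin k → ℝ, (∀ n j, 0 < a n j) ∧
    TendstoInDistribution (fun (n : ℕ) ω j => (sampleMax Z n ω j - b n j) / a n j)
      atTop G (fun _ => P) P'

/-- The finite set of partitions of the index set of the `k` locations. -/
abbrev Partitions (k : ℕ) : Type := Finpartition (Finset.univ : Finset (Fin k))

instance (k : ℕ) : TopologicalSpace (Partitions k) := ⊥
instance (k : ℕ) : DiscreteTopology (Partitions k) := ⟨rfl⟩
instance (k : ℕ) : MeasurableSpace (Partitions k) := ⊤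
instance (k : ℕ) : BorelSpace (Partitions k) := ⟨by rw [borel_eq_top_of_discrete]; rfl⟩

/-- The set of indices at which a family of reals attains its maximum. -/
def argMax {ι : Type*} (u : ι → ℝ) : Set ι := {i | ∀ i', u i' ≤ u i}

/-- Two indices are equivalent if the family `ψ` is maximal in these coordinates at the same
place. -/
def sameArgMax {ι : Type*} {k : ℕ} (ψ : ι → Fin k → ℝ) : Setoid (Fin k) :=
  Setoid.comap (fun j => argMax fun i => ψ i j) ⊥

open Classical in
/-- Hitting scenario of a family `ψ` of vectors: the partition of the coordinates in which `j₁, j₂`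
are in the same block iff `argmax_i ψ_i(j₁) = argmax_i ψ_i(j₂)`. -/
def hittingScenario {ι : Type*} {k : ℕ} (ψ : ι → Fin k → ℝ) : Partitions k :=
  Finpartition.ofSetoid (sameArgMax ψ)

theorem mem_same_block_iff {ι : Type*} {k : ℕ} (ψ : ι → Fin k → ℝ) (j₁ j₂ : Fin k) :
    j₂ ∈ (hittingScenario ψ).part j₁ ↔
      argMax (fun i => ψ i j₁) = argMax (fun i => ψ i j₂) := by
  classical
  unfold hittingScenario
  rw [Finpartition.mem_part_ofSetoid_iff_rel]
  rfl

/-- The sample hitting scenario `π_n` of the first `n` observations at the locations `s`. -/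
def sampleScenario {Ω T : Type*} {k : ℕ} (X : ℕ → Ω → T → ℝ) (s : Fin k → T) (n : ℕ)
    (ω : Ω) : Partitions k :=
  hittingScenario fun (i : Fin n) j => X i ω (s j)

/-- The extremal hitting scenario `π` at the locations `s`. -/
def extremalScenario {Ω T : Type*} {k : ℕ} (ζ : ℕ → Ω → ℝ) (Y : ℕ → Ω → T → ℝ) (s : Fin k → T)
    (ω : Ω) : Partitions k :=
  hittingScenario fun (i : ℕ) j => spectralPoint ζ Y i ω (s j)

/-- The set `C_i` of the locations at which the `i`-th of the first `n` observations attains the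
componentwise maximum. -/
def dominatedSet {Ω T : Type*} {k : ℕ} (X : ℕ → Ω → T → ℝ) (s : Fin k → T) (n : ℕ)
    (ω : Ω) (i : Fin n) : Set (Fin k) :=
  {j | sampleMax X n ω (s j) = X i ω (s j)}

/-- The sample concurrence probability `p_n`. -/
def sampleConcurrenceProb {Ω T : Type*} [MeasurableSpace Ω] {k : ℕ} (X : ℕ → Ω → T → ℝ)
    (P : Measure Ω) (s : Fin k → T) (n : ℕ) : ℝ :=
  P.real {ω | ∃ l : Fin n, ∀ j, sampleMax X n ω (s j) = X l ω (s j)}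

/-- The extremal concurrence probability `p`. -/
def extremalConcurrenceProb {Ω T : Type*} [MeasurableSpace Ω] {k : ℕ} (ζ : ℕ → Ω → ℝ)
    (Y : ℕ → Ω → T → ℝ) (P : Measure Ω) (s : Fin k → T) : ℝ :=
  P.real {ω | ∃ l : ℕ, ∀ j, maxStable ζ Y ω (s j) = spectralPoint ζ Y l ω (s j)}

end

end Concurrence

open Concurrence

namespace Concurrence

open scoped ENNReal NNReal

/-! A hitting scenario depends only on the order of the values at each site, so strictly increasing
marginal maps, centring and scaling leave it unchanged. It suffices to compare a normalized i.i.d.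
row `W n 0, …, W n (n-1)` with the points `ζ i • V i`, where `V i` is `Y i` at the sites.

Write `Λ` for `exponentMeasure`, the intensity of these points. Conditioning on `ζ` and using the
generating functional of a Poisson process gives the avoidance probability `exp (-Λ R)` for sets `R`
of finite intensity. Unit means give `Λ {y | x < y j} = 1 / x`. Convergence of the maxima therefore
says that `n` times the law of `W n 0` converges to `Λ` on complements of orthants, and by
differencing on finer sets.

The argmax is not a continuous functional, so each coordinate is rounded to `L` positive levels of
`Λ`-mass `1 / ρ` each. Suppose every coordinate has a point of positive level and no two points
share a positive level in a coordinate (`IsSeparated`). Then the scenario is a function of the set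
of occupied nonzero cells (`IsSeparated.hittingScenario_eq`). For fixed `L` and `ρ` this random
subset of a finite set converges in law, because its avoidance probabilities do
(`tendsto_measureReal_comp`). Separation fails for the limit with probability at most `k * exp (-L /
ρ) + k * L / ρ ^ 2`, and for the row with a probability bounded by a sequence tending to the same
number. Taking `L = m ^ 3`, `ρ = m ^ 2` and `m → ∞` makes this negligible
(`tendsto_measureReal_hittingScenario`).

The same estimates show that the maxima of the limit are almost surely unique, since tied points
share a level on every grid. Concurrence is then, up to null sets, the event that all sites lie in
one block, so its probability is a finite sum of scenario probabilities. -/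

theorem lintegral_pow_poissonMeasure (r : ℝ≥0) {c : ℝ} (hc : 0 ≤ c) :
    ∫⁻ n, ENNReal.ofReal c ^ n ∂poissonMeasure r = ENNReal.ofReal (Real.exp (-(r * (1 - c)))) := by
  rw [lintegral_countable']
  have h : HasSum (fun n : ℕ => Real.exp (-r) * ((r * c) ^ n / n.factorial))
      (Real.exp (-(r * (1 - c)))) := by
    have := (NormedSpace.expSeries_div_hasSum_exp (r * c : ℝ)).mul_left (Real.exp (-r))
    rw [← Real.exp_eq_exp_ℝ, ← Real.exp_add] at this
    convert! this using 2
    ring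
  rw [← h.tsum_eq, ENNReal.ofReal_tsum_of_nonneg (fun n => by positivity) h.summable]
  refine tsum_congr fun n => ?_
  rw [poissonMeasure_singleton, ← ENNReal.ofReal_pow hc, ← ENNReal.ofReal_mul (by positivity)]
  congr 1
  rw [mul_pow]
  ring

theorem lintegral_natCast_poissonMeasure (r : ℝ≥0) :
    ∫⁻ n : ℕ, (n : ℝ≥0∞) ∂poissonMeasure r = r := by
  rw [lintegral_countable']
  have h : HasSum (fun n : ℕ => Real.exp (-r) * (r * ((r : ℝ) ^ n / n.factorial))) r := by
    have := ((NormedSpace.expSeries_div_hasSum_exp (r : ℝ)).mul_left (r : ℝ)).mul_left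
      (Real.exp (-r))
    rw [← Real.exp_eq_exp_ℝ, mul_comm (r : ℝ) (Real.exp _), ← mul_assoc, ← Real.exp_add] at this
    simpa using this
  rw [tsum_eq_zero_add' ENNReal.summable]
  have h2 : (r : ℝ≥0∞) = ENNReal.ofReal r := by simp
  rw [h2, ← h.tsum_eq, ENNReal.ofReal_tsum_of_nonneg (fun n => by positivity) h.summable]
  simp only [Nat.cast_zero, zero_mul, zero_add]
  refine tsum_congr fun n => ?_
  rw [poissonMeasure_singleton, ← ENNReal.ofReal_natCast, ← ENNReal.ofReal_mul (by positivity)]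
  congr 1
  rw [Nat.factorial_succ]
  push_cast
  field_simp
  ring

/-! ### Poisson processes: finiteness, intensity and generating functional -/

section Poisson

variable {Ω E : Type*} [MeasurableSpace Ω] [MeasurableSpace E] {ξ : ℕ → Ω → E} {μ : Measure E}
  {P : Measure Ω}

theorem IsPoissonProcess.ae_finite (hξ : IsPoissonProcess ξ μ P) {A : Set E}
    (hA : MeasurableSet A) (hμ : μ A ≠ ∞) : ∀ᵐ ω ∂P, {i | ξ i ω ∈ A}.Finite := by
  have hl := hξ.law_count A hA hμ
  have h0 : P {ω | pointCount ξ A ω = ⊤} = 0 := by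
    rw [hl.measure_eq (p := fun x => x = ⊤) .of_discrete,
      Measure.map_apply .of_discrete .of_discrete]
    have : ((↑) : ℕ → ℕ∞) ⁻¹' {x | x = ⊤} = ∅ := by ext n; simp
    rw [this, measure_empty]
  filter_upwards [measure_eq_zero_iff_ae_notMem.1 h0] with ω hω
  by_contra h
  exact hω (Set.encard_eq_top_iff.2 h)

/-- The expected number of points in a set of finite intensity. -/
theorem IsPoissonProcess.tsum_measure_of_ne_top (hξ : IsPoissonProcess ξ μ P) {A : Set E}
    (hA : MeasurableSet A) (hμ : μ A ≠ ∞) : ∑' i, P.map (ξ i) A = μ A := by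
  have hl := hξ.law_count A hA hμ
  have h1 : ∀ᵐ ω ∂P, ∑' i, (ξ i ⁻¹' A).indicator 1 ω = ((pointCount ξ A ω).toNat : ℝ≥0∞) := by
    filter_upwards [hξ.ae_finite hA hμ] with ω hω
    rw [tsum_eq_sum (s := hω.toFinset) (fun i hi => by simpa using hi)]
    rw [Finset.sum_congr rfl (g := fun _ => (1 : ℝ≥0∞)) (fun i hi => by
      rw [Finite.mem_toFinset] at hi
      exact indicator_of_mem (s := ξ i ⁻¹' A) hi 1)]
    simp only [Finset.sum_const, nsmul_eq_mul, mul_one, pointCount]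
    rw [hω.encard_eq_coe_toFinset_card]
    simp
  have h2 : ∫⁻ ω, ((pointCount ξ A ω).toNat : ℝ≥0∞) ∂P = μ A := by
    have := hl.aemeasurable
    rw [← lintegral_map' (μ := P) (g := pointCount ξ A) (f := fun n : ℕ∞ => (n.toNat : ℝ≥0∞))
      (Measurable.of_discrete.aemeasurable) hl.aemeasurable, hl.map_eq,
      lintegral_map .of_discrete .of_discrete]
    simp [lintegral_natCast_poissonMeasure, ENNReal.coe_toNNReal hμ]
  rw [← h2, ← lintegral_congr_ae h1, lintegral_tsum]
  · refine tsum_congr fun i => ?_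
    rw [lintegral_indicator_one (hξ.measurable i hA), Measure.map_apply (hξ.measurable i) hA]
  · exact fun i => (measurable_one.indicator (hξ.measurable i hA)).aemeasurable

theorem IsPoissonProcess.sum_map [SigmaFinite μ] (hξ : IsPoissonProcess ξ μ P) :
    Measure.sum (fun i => P.map (ξ i)) = μ := by
  ext A hA
  have key : ∀ n, Measure.sum (fun i => P.map (ξ i)) (A ∩ spanningSets μ n) =
      μ (A ∩ spanningSets μ n) := fun n => by
    -- The count laws speak only about sets of finite intensity, so the identity is localized to
    -- spanning sets and recovered by monotone limits.
    have hm : MeasurableSet (A ∩ spanningSets μ n) := hA.inter (measurableSet_spanningSets μ n)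
    rw [Measure.sum_apply _ hm]
    exact hξ.tsum_measure_of_ne_top hm
      (ne_top_of_le_ne_top (measure_spanningSets_lt_top μ n).ne (measure_mono inter_subset_right))
  have hmono : Monotone fun n => A ∩ spanningSets μ n := fun a b h =>
    inter_subset_inter_right _ (monotone_spanningSets μ h)
  have hU : A = ⋃ n, A ∩ spanningSets μ n := by rw [← inter_iUnion, iUnion_spanningSets, inter_univ]
  rw [hU, hmono.measure_iUnion, hmono.measure_iUnion]
  exact iSup_congr key

/-- Factors equal to 1 do not matter and the others are finitely many, so the decreasing partial
products stabilize. Grouping the factors by value turns an infinite product over points into powers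
of point counts, whose joint law is known. -/
theorem iInf_prod_range_eq_prod {ι : Type*} (g : ι → ℝ≥0∞) (hg : ∀ x, g x ≤ 1) (x : ℕ → ι)
    (T : Finset ℝ≥0∞) (hT : ∀ y, g y ∈ insert 1 T)
    (hfin : ∀ c ∈ T, {i | g (x i) = c}.Finite) :
    ⨅ n : ℕ, ∏ i ∈ Finset.range n, g (x i) = ∏ c ∈ T, c ^ {i | g (x i) = c}.encard.toNat := by
  classical
  have hS : {i | g (x i) ∈ T}.Finite := by
    have : {i | g (x i) ∈ T} = ⋃ c ∈ T, {i | g (x i) = c} := by ext; simp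
    rw [this]
    exact T.finite_toSet.biUnion hfin
  obtain ⟨N, hN⟩ := hS.bddAbove
  have hanti : Antitone fun n : ℕ => ∏ i ∈ Finset.range n, g (x i) := antitone_nat_of_succ_le
    fun n => by
      rw [Finset.prod_range_succ]
      exact mul_le_of_le_one_right' (hg _)
  have hconst : ∀ n, N + 1 ≤ n →
      ∏ i ∈ Finset.range n, g (x i) = ∏ i ∈ hS.toFinset, g (x i) := fun n hn => by
    symm
    refine Finset.prod_subset (fun i hi => ?_) fun i _ hi => ?_
    · have := hN (hS.mem_toFinset.1 hi)
      exact Finset.mem_range.2 (by omega)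
    · have h := hT (x i)
      rw [Finset.mem_insert] at h
      exact h.resolve_right fun h' => hi (hS.mem_toFinset.2 h')
  have hinf : ⨅ n : ℕ, ∏ i ∈ Finset.range n, g (x i) = ∏ i ∈ hS.toFinset, g (x i) := by
    refine le_antisymm ((iInf_le _ (N + 1)).trans_eq (hconst _ le_rfl)) (le_iInf fun n => ?_)
    rw [← hconst (max n (N + 1)) (le_max_right _ _)]
    exact hanti (le_max_left _ _)
  rw [hinf, ← Finset.prod_fiberwise_of_maps_to (t := T) (g := fun i => g (x i))
    (fun i hi => by simpa using hi)]
  refine Finset.prod_congr rfl fun c hc => ?_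
  rw [Finset.prod_congr rfl (g := fun _ => c) (fun i hi => by simpa using (Finset.mem_filter.1 hi).2),
    Finset.prod_const, (hfin c hc).encard_eq_coe_toFinset_card, ENat.toNat_natCast]
  congr 2
  ext i
  simp only [Finset.mem_filter, Finite.mem_toFinset, mem_ofPred_eq]
  exact ⟨fun h => h.2, fun h => ⟨h ▸ hc, h⟩⟩

end Poisson

section Poisson

variable {Ω E : Type*} [MeasurableSpace Ω] [MeasurableSpace E] {ξ : ℕ → Ω → E} {μ : Measure E}
  {P : Measure Ω}

theorem IsPoissonProcess.lintegral_pow_pointCount (hξ : IsPoissonProcess ξ μ P) {A : Set E}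
    (hA : MeasurableSet A) (hμ : μ A ≠ ∞) {c : ℝ≥0∞} (hc : c ≤ 1) :
    ∫⁻ ω, c ^ (pointCount ξ A ω).toNat ∂P =
      ENNReal.ofReal (Real.exp (-((1 - c) * μ A).toReal)) := by
  have hl := hξ.law_count A hA hμ
  have hc' : c ≠ ∞ := ne_top_of_le_ne_top ENNReal.one_ne_top hc
  rw [← lintegral_map' (μ := P) (g := pointCount ξ A) (f := fun n : ℕ∞ => c ^ n.toNat)
      (Measurable.of_discrete.aemeasurable) hl.aemeasurable, hl.map_eq,
      lintegral_map .of_discrete .of_discrete]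
  simp only [ENat.toNat_natCast]
  have h := lintegral_pow_poissonMeasure (μ A).toNNReal (c := c.toReal) ENNReal.toReal_nonneg
  rw [ENNReal.ofReal_toReal hc'] at h
  rw [h, ENNReal.toReal_mul, ENNReal.toReal_sub_of_le hc ENNReal.one_ne_top, mul_comm]
  rfl

/-- The counts on the level sets of `1 - q` are independent Poisson variables, so the expectation
factors into Poisson generating functions. The level set `q = 0` is left out: it may have infinite
intensity, but contributes only factors 1. -/
theorem IsPoissonProcess.lintegral_iInf_prod_simpleFunc (hξ : IsPoissonProcess ξ μ P)
    (q : SimpleFunc E ℝ≥0∞) (hq : ∀ x, q x ≤ 1) (hfin : ∫⁻ x, q x ∂μ ≠ ∞) :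
    ∫⁻ ω, ⨅ n : ℕ, ∏ i ∈ Finset.range n, (1 - q (ξ i ω)) ∂P =
      ENNReal.ofReal (Real.exp (-(∫⁻ x, q x ∂μ).toReal)) := by
  classical
  set g : SimpleFunc E ℝ≥0∞ := q.map (fun y => 1 - y) with hg
  have hgq : ∀ x, g x = 1 - q x := fun x => rfl
  have hqg : ∀ x, q x = 1 - g x := fun x => by
    rw [hgq, ENNReal.sub_sub_cancel ENNReal.one_ne_top (hq x)]
  set T : Finset ℝ≥0∞ := g.range.erase 1 with hT
  have hmeas : ∀ c, MeasurableSet (g ⁻¹' {c}) := g.measurableSet_fiber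
  have hT1 : ∀ c ∈ T, c ≤ 1 := fun c hc => by
    obtain ⟨x, rfl⟩ := SimpleFunc.mem_range.1 (Finset.mem_of_mem_erase hc)
    exact tsub_le_self
  have hμ : ∀ c ∈ T, μ (g ⁻¹' {c}) ≠ ∞ := fun c hc => by
    have hsub : g ⁻¹' {c} ⊆ q ⁻¹' {1 - c} := fun x hx => by
      rw [mem_preimage, mem_singleton_iff] at hx ⊢
      rw [hqg, hx]
    have h0 : 1 - c ≠ 0 := by
      rw [Ne, tsub_eq_zero_iff_le]
      exact fun h => Finset.ne_of_mem_erase hc (le_antisymm (hT1 c hc) h)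
    rw [SimpleFunc.lintegral_eq_lintegral] at hfin
    exact ne_top_of_le_ne_top (SimpleFunc.finMeasSupp_iff.1
      (SimpleFunc.FinMeasSupp.of_lintegral_ne_top hfin) _ h0).ne (measure_mono hsub)
  have hae : ∀ᵐ ω ∂P, ⨅ n : ℕ, ∏ i ∈ Finset.range n, (1 - q (ξ i ω)) =
      ∏ c ∈ T, c ^ (pointCount ξ (g ⁻¹' {c}) ω).toNat := by
    have : ∀ᵐ ω ∂P, ∀ c ∈ T, {i | ξ i ω ∈ g ⁻¹' {c}}.Finite :=
      (ae_ball_iff T.countable_toSet).2 fun c hc => hξ.ae_finite (hmeas c) (hμ c hc)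
    filter_upwards [this] with ω hω
    refine iInf_prod_range_eq_prod g (fun x => tsub_le_self) (fun i => ξ i ω) T (fun y => ?_) hω
    rw [hT, Finset.mem_insert]
    by_cases h : g y = 1
    · exact Or.inl h
    · exact Or.inr (Finset.mem_erase.2 ⟨h, g.mem_range_self y⟩)
  rw [lintegral_congr_ae hae]
  let e := T.equivFin
  have hind : iIndepFun (fun c : T => pointCount ξ (g ⁻¹' {(c : ℝ≥0∞)})) P := by
    have h := hξ.indep_count T.card (fun l => g ⁻¹' {((e.symm l : T) : ℝ≥0∞)}) (fun l => hmeas _)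
      (fun l l' hl => by
        refine Disjoint.preimage _ (disjoint_singleton.2 fun h => hl ?_)
        exact e.symm.injective (Subtype.ext h))
    have h' := h.precomp (g := e) e.injective
    simpa using h'
  have hAE : ∀ c : T, AEMeasurable (pointCount ξ (g ⁻¹' {(c : ℝ≥0∞)})) P := fun c =>
    (hξ.law_count _ (hmeas c) (hμ c c.2)).aemeasurable
  have hind2 := (hind.congr fun c => (hAE c).ae_eq_mk).comp
    (fun (c : T) (n : ℕ∞) => (c : ℝ≥0∞) ^ n.toNat) (fun _ => .of_discrete)
  have hprod := lintegral_prod_eq_prod_lintegral_of_indepFun Finset.univ _ hind2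
    (fun c => Measurable.of_discrete.comp (hAE c).measurable_mk)
  have hlhs : ∫⁻ ω, ∏ c ∈ T, c ^ (pointCount ξ (g ⁻¹' {c}) ω).toNat ∂P =
      ∏ c ∈ T, ∫⁻ ω, c ^ (pointCount ξ (g ⁻¹' {c}) ω).toNat ∂P := by
    rw [← Finset.prod_coe_sort T
      (fun c => ∫⁻ ω, c ^ (pointCount ξ (g ⁻¹' {c}) ω).toNat ∂P)]
    have e1 : ∀ c : T, ∫⁻ ω, (c : ℝ≥0∞) ^ (pointCount ξ (g ⁻¹' {(c : ℝ≥0∞)}) ω).toNat ∂P =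
        ∫⁻ ω, (c : ℝ≥0∞) ^ ((hAE c).mk _ ω).toNat ∂P := fun c =>
      lintegral_congr_ae <| by
        filter_upwards [(hAE c).ae_eq_mk] with ω hω
        rw [hω]
    simp only [e1]
    refine Eq.trans (lintegral_congr_ae ?_) hprod
    filter_upwards [ae_all_iff.2 fun c => (hAE c).ae_eq_mk] with ω hω
    rw [← Finset.prod_coe_sort T]
    refine Finset.prod_congr rfl fun c _ => ?_
    simp only [Function.comp, hω c]
  rw [hlhs, Finset.prod_congr rfl fun c hc =>
    hξ.lintegral_pow_pointCount (hmeas c) (hμ c hc) (hT1 c hc),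
    ← ENNReal.ofReal_prod_of_nonneg (fun _ _ => (Real.exp_pos _).le), ← Real.exp_sum]
  congr 2
  rw [Finset.sum_neg_distrib, ← ENNReal.toReal_sum]
  · congr 2
    have hq' : ∫⁻ x, q x ∂μ = (g.map fun y => 1 - y).lintegral μ := by
      rw [← SimpleFunc.lintegral_eq_lintegral]
      exact lintegral_congr hqg
    rw [hq', SimpleFunc.map_lintegral]
    refine Finset.sum_subset (Finset.erase_subset _ _) fun c hc hc' => ?_
    have : c = 1 := by
      by_contra h
      exact hc' (Finset.mem_erase.2 ⟨h, hc⟩)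
    simp [this]
  · exact fun c hc => ENNReal.mul_ne_top
      (ne_top_of_le_ne_top ENNReal.one_ne_top tsub_le_self) (hμ c hc)

/-- The generating functional of a Poisson process. -/
theorem IsPoissonProcess.lintegral_iInf_prod (hξ : IsPoissonProcess ξ μ P) [IsProbabilityMeasure P]
    {q : E → ℝ≥0∞} (hqm : Measurable q) (hq : ∀ x, q x ≤ 1) (hfin : ∫⁻ x, q x ∂μ ≠ ∞) :
    ∫⁻ ω, ⨅ n : ℕ, ∏ i ∈ Finset.range n, (1 - q (ξ i ω)) ∂P =
      ENNReal.ofReal (Real.exp (-(∫⁻ x, q x ∂μ).toReal)) := by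
  set s : ℕ → SimpleFunc E ℝ≥0∞ := SimpleFunc.eapprox q with hs
  have hsup : ∀ x, ⨆ r, s r x = q x := SimpleFunc.iSup_eapprox_apply hqm
  have hmono : Monotone s := SimpleFunc.monotone_eapprox q
  have hle : ∀ r x, s r x ≤ q x := fun r x => (hsup x) ▸ le_iSup (fun r => s r x) r
  have hint : ∫⁻ x, q x ∂μ = ⨆ r, ∫⁻ x, s r x ∂μ := by
    rw [← lintegral_iSup (fun r => (s r).measurable) (fun a b h x => hmono h x)]
    exact lintegral_congr fun x => (hsup x).symm
  have hmeas : ∀ r, Measurable fun ω => ⨅ n : ℕ, ∏ i ∈ Finset.range n, (1 - s r (ξ i ω)) :=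
    fun r => Measurable.iInf fun n => Finset.measurable_prod _ fun i _ =>
      measurable_const.sub ((s r).measurable.comp (hξ.measurable i))
  have hanti : Antitone fun r => fun ω => ⨅ n : ℕ, ∏ i ∈ Finset.range n, (1 - s r (ξ i ω)) :=
    fun a b h ω => iInf_mono fun n => Finset.prod_le_prod' fun i _ =>
      tsub_le_tsub_left (hmono h _) 1
  -- Both limits are infima of decreasing families, so they commute.
  have hpt : ∀ ω, ⨅ n : ℕ, ∏ i ∈ Finset.range n, (1 - q (ξ i ω)) =
      ⨅ r, ⨅ n : ℕ, ∏ i ∈ Finset.range n, (1 - s r (ξ i ω)) := fun ω => by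
    rw [iInf_comm]
    refine iInf_congr fun n => ?_
    have ht : ∀ i, Tendsto (fun r => 1 - s r (ξ i ω)) atTop (𝓝 (1 - q (ξ i ω))) := fun i => by
      refine ENNReal.Tendsto.sub tendsto_const_nhds ?_ (Or.inl ENNReal.one_ne_top)
      rw [← hsup]
      exact tendsto_atTop_iSup fun a b h => hmono h _
    have h1 := ENNReal.tendsto_finsetProd_of_ne_top (Finset.range n) (fun i _ => ht i)
      (fun i _ => ne_top_of_le_ne_top ENNReal.one_ne_top tsub_le_self)
    have h2 : Antitone fun r => ∏ i ∈ Finset.range n, (1 - s r (ξ i ω)) := fun a b h =>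
      Finset.prod_le_prod' fun i _ => tsub_le_tsub_left (hmono h _) 1
    exact tendsto_nhds_unique h1 (tendsto_atTop_iInf h2)
  have hfin' : ∀ r, ∫⁻ x, s r x ∂μ ≠ ∞ := fun r =>
    ne_top_of_le_ne_top hfin (lintegral_mono (hle r))
  simp only [hpt]
  rw [lintegral_iInf hmeas hanti]
  · simp only [fun r => hξ.lintegral_iInf_prod_simpleFunc (s r) (fun x => (hle r x).trans (hq x))
      (hfin' r)]
    have hm : Monotone fun r => ∫⁻ x, s r x ∂μ := fun a b h => lintegral_mono (hmono h)
    have h1 : Tendsto (fun r => ∫⁻ x, s r x ∂μ) atTop (𝓝 (∫⁻ x, q x ∂μ)) := by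
      rw [hint]
      exact tendsto_atTop_iSup hm
    have h2 : Tendsto (fun r => ENNReal.ofReal (Real.exp (-(∫⁻ x, s r x ∂μ).toReal))) atTop
        (𝓝 (ENNReal.ofReal (Real.exp (-(∫⁻ x, q x ∂μ).toReal)))) :=
      ENNReal.tendsto_ofReal ((Real.continuous_exp.tendsto _).comp
        ((ENNReal.tendsto_toReal hfin).comp h1).neg)
    refine tendsto_nhds_unique (tendsto_atTop_iInf fun a b h => ?_) h2
    exact ENNReal.ofReal_le_ofReal (Real.exp_le_exp.2 (neg_le_neg
      (ENNReal.toReal_mono (hfin' b) (hm h))))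
  · refine ne_top_of_le_ne_top ENNReal.one_ne_top ?_
    calc _ ≤ ∫⁻ _, 1 ∂P := lintegral_mono fun ω => (iInf_le _ 0).trans (by simp)
      _ = 1 := by simp

end Poisson

/-! ### The marked points `ζ i • V i` and their intensity -/

theorem invSqIntensity_Ioi {c : ℝ} (hc : 0 < c) :
    invSqIntensity (Ioi c) = ENNReal.ofReal (1 / c) := by
  have hf : Measurable fun z : ℝ => ENNReal.ofReal (1 / z ^ 2) := by fun_prop
  rw [invSqIntensity, withDensity_apply _ measurableSet_Ioi,
    Measure.restrict_restrict measurableSet_Ioi, inter_eq_left.2 (Ioi_subset_Ioi hc.le)]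
  have h1 : ∀ z ∈ Ioi c, (1 / z ^ 2 : ℝ) = z ^ (-2 : ℝ) := fun z hz => by
    rw [Real.rpow_neg (hc.trans hz).le, one_div]
    norm_cast
  rw [setLIntegral_congr_fun measurableSet_Ioi (g := fun z : ℝ => ENNReal.ofReal (z ^ (-2 : ℝ)))
    (fun z hz => congrArg ENNReal.ofReal (h1 z hz)),
    ← ofReal_integral_eq_lintegral_ofReal (integrableOn_Ioi_rpow_of_lt (by norm_num) hc)]
  · rw [integral_Ioi_rpow_of_lt (by norm_num) hc]
    congr 1
    norm_num [Real.rpow_neg_one]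
  · filter_upwards [self_mem_ae_restrict measurableSet_Ioi] with z hz
    exact Real.rpow_nonneg (hc.trans hz).le _

instance : SigmaFinite invSqIntensity := by
  unfold invSqIntensity
  infer_instance

/-- A Poisson process on `(0, ∞)` with intensity `z⁻² dz`, marked by independent copies of a
nonnegative random vector with unit means. -/
structure IsSpectralVector {Ω : Type*} {k : ℕ} [MeasurableSpace Ω] (ζ : ℕ → Ω → ℝ)
    (V : ℕ → Ω → Fin k → ℝ) (P : Measure Ω) : Prop where
  poisson : IsPoissonProcess ζ invSqIntensity P
  measurable : ∀ i, Measurable (V i)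
  iIndep : iIndepFun V P
  identDistrib : ∀ i, IdentDistrib (V i) (V 0) P P
  indep : IndepFun (fun ω i => ζ i ω) (fun ω i => V i ω) P
  nonneg : ∀ i ω j, 0 ≤ V i ω j
  mean_eq_one : ∀ j, ∫ ω, V 0 ω j ∂P = 1

theorem IsSpectralRepresentation.isSpectralVector {Ω T : Type*} [MeasurableSpace Ω]
    [TopologicalSpace T] {ζ : ℕ → Ω → ℝ} {Y : ℕ → Ω → T → ℝ} {P : Measure Ω}
    (h : IsSpectralRepresentation ζ Y P) {k : ℕ} (s : Fin k → T) :
    IsSpectralVector ζ (fun i ω j => Y i ω (s j)) P where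
  poisson := h.poisson
  measurable i := measurable_pi_lambda _ fun j => h.copies.measurable i (s j)
  iIndep := h.copies.indep.comp (fun _ y j => y (s j))
    fun _ => measurable_pi_lambda _ fun _ => measurable_pi_apply _
  identDistrib i := (h.copies.identDistrib i).comp
    (u := fun y j => y (s j)) (measurable_pi_lambda _ fun _ => measurable_pi_apply _)
  indep := h.indep.comp (φ := id) (ψ := fun (y : ℕ → T → ℝ) i j => y i (s j)) measurable_id
    (measurable_pi_lambda _ fun i => measurable_pi_lambda _ fun j =>
      (measurable_pi_apply (s j)).comp (measurable_pi_apply i))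
  nonneg i ω j := h.nonneg i ω (s j)
  mean_eq_one j := h.mean_eq_one (s j)

/-- The intensity of the points `ζ_i V_i` if the `V_i` have law `κ`. -/
noncomputable def exponentMeasure {k : ℕ} (κ : Measure (Fin k → ℝ)) : Measure (Fin k → ℝ) :=
  (invSqIntensity.prod κ).map fun p => p.1 • p.2

theorem measurable_smul_vector (k : ℕ) :
    Measurable fun p : ℝ × (Fin k → ℝ) => p.1 • p.2 := by fun_prop

theorem exponentMeasure_apply {k : ℕ} (κ : Measure (Fin k → ℝ)) [SFinite κ] {R : Set (Fin k → ℝ)}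
    (hR : MeasurableSet R) :
    exponentMeasure κ R = ∫⁻ z, κ {v | z • v ∈ R} ∂invSqIntensity := by
  rw [exponentMeasure, Measure.map_apply (measurable_smul_vector k) hR,
    Measure.prod_apply (measurable_smul_vector k hR)]
  rfl

section SpectralVector

variable {Ω : Type*} [MeasurableSpace Ω] {k : ℕ} {ζ : ℕ → Ω → ℝ} {V : ℕ → Ω → Fin k → ℝ}
  {P : Measure Ω}

theorem IsSpectralVector.measurable_point (h : IsSpectralVector ζ V P) (i : ℕ) :
    Measurable fun ω => ζ i ω • V i ω :=
  (measurable_smul_vector k).comp ((h.poisson.measurable i).prodMk (h.measurable i))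

/-- If `N` is the number of events that occur, then `1_{N ≥ 2} + 1_{N ≥ 1} ≤ N` pointwise;
integrate. -/
theorem measure_exists_ne_add_le {E : ℕ → Set Ω} (hE : ∀ i, MeasurableSet (E i)) :
    P {ω | ∃ i i', i ≠ i' ∧ ω ∈ E i ∧ ω ∈ E i'} + P {ω | ∃ i, ω ∈ E i} ≤ ∑' i, P (E i) := by
  classical
  have h2 : MeasurableSet {ω | ∃ i i', i ≠ i' ∧ ω ∈ E i ∧ ω ∈ E i'} := by
    have : {ω | ∃ i i', i ≠ i' ∧ ω ∈ E i ∧ ω ∈ E i'} =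
        ⋃ i, ⋃ i', ⋃ _ : i ≠ i', E i ∩ E i' := by
      ext ω
      simp only [mem_ofPred_eq, mem_iUnion, mem_inter_iff, exists_prop]
    rw [this]
    exact MeasurableSet.iUnion fun i => MeasurableSet.iUnion fun i' => MeasurableSet.iUnion
      fun _ => (hE i).inter (hE i')
  have h1 : MeasurableSet {ω | ∃ i, ω ∈ E i} := by
    have : {ω | ∃ i, ω ∈ E i} = ⋃ i, E i := by ext; simp
    rw [this]
    exact MeasurableSet.iUnion hE
  rw [← lintegral_indicator_one h2, ← lintegral_indicator_one h1,
    ← lintegral_add_left (measurable_one.indicator h2)]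
  calc _ ≤ ∫⁻ ω, ∑' i, (E i).indicator 1 ω ∂P := lintegral_mono fun ω => ?_
    _ = ∑' i, P (E i) := by
      rw [lintegral_tsum fun i => (measurable_one.indicator (hE i)).aemeasurable]
      exact tsum_congr fun i => lintegral_indicator_one (hE i)
  by_cases hω : ∃ i i', i ≠ i' ∧ ω ∈ E i ∧ ω ∈ E i'
  · obtain ⟨i, i', hne, hi, hi'⟩ := hω
    refine le_trans ?_ (ENNReal.sum_le_tsum {i, i'})
    rw [Finset.sum_pair hne, indicator_of_mem hi, indicator_of_mem hi']
    exact add_le_add (indicator_le_self' (fun _ _ => zero_le) _)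
      (indicator_le_self' (fun _ _ => zero_le) _)
  · rw [indicator_of_notMem (s := {ω | ∃ i i', i ≠ i' ∧ ω ∈ E i ∧ ω ∈ E i'}) hω, zero_add]
    by_cases hω' : ∃ i, ω ∈ E i
    · obtain ⟨i, hi⟩ := hω'
      refine le_trans ?_ (ENNReal.le_tsum i)
      rw [indicator_of_mem hi]
      exact indicator_le_self' (fun _ _ => zero_le) _
    · rw [indicator_of_notMem (s := {ω | ∃ i, ω ∈ E i}) hω']
      exact zero_le

variable [IsProbabilityMeasure P]

theorem IsSpectralVector.isProbabilityMeasure_map (h : IsSpectralVector ζ V P) :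
    IsProbabilityMeasure (P.map (V 0)) :=
  Measure.isProbabilityMeasure_map (h.measurable 0).aemeasurable

theorem IsSpectralVector.map_prod (h : IsSpectralVector ζ V P) :
    P.map (fun ω => ((fun i => ζ i ω), fun i => V i ω)) =
      (P.map fun ω i => ζ i ω).prod (Measure.infinitePi fun _ : ℕ => P.map (V 0)) := by
  have hζ : Measurable fun ω i => ζ i ω := measurable_pi_lambda _ h.poisson.measurable
  have hV : Measurable fun ω i => V i ω := measurable_pi_lambda _ h.measurable
  rw [(indepFun_iff_map_prod_eq_prod_map_map hζ.aemeasurable hV.aemeasurable).1 h.indep,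
    (iIndepFun_iff_map_fun_eq_infinitePi_map h.measurable).1 h.iIndep]
  simp only [fun i => (h.identDistrib i).map_eq]

/-- Conditionally on `ζ` the marks are still i.i.d., so the points avoid `R` independently of each
other. The right side is a truncation of the generating functional of `ζ`. -/
theorem IsSpectralVector.measure_forall_lt (h : IsSpectralVector ζ V P) {R : Set (Fin k → ℝ)}
    (hR : MeasurableSet R) (n : ℕ) :
    P {ω | ∀ i < n, ζ i ω • V i ω ∉ R} =
      ∫⁻ ω, ∏ i ∈ Finset.range n, (1 - P.map (V 0) {v | ζ i ω • v ∈ R}) ∂P := by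
  have := h.isProbabilityMeasure_map
  have hζ : Measurable fun ω i => ζ i ω := measurable_pi_lambda _ h.poisson.measurable
  have hV : Measurable fun ω i => V i ω := measurable_pi_lambda _ h.measurable
  have hz : ∀ z : ℝ, MeasurableSet {v : Fin k → ℝ | z • v ∈ R} := fun z =>
    ((measurable_smul_vector k).comp measurable_prodMk_left) hR
  set S : Set ((ℕ → ℝ) × (ℕ → Fin k → ℝ)) := {p | ∀ i < n, p.1 i • p.2 i ∉ R} with hS
  have hSm : MeasurableSet S := by
    have : S = ⋂ i, ⋂ _ : i < n, {p | p.1 i • p.2 i ∈ R}ᶜ := by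
      ext p
      simp [hS]
    rw [this]
    refine MeasurableSet.iInter fun i => MeasurableSet.iInter fun _ => MeasurableSet.compl ?_
    have hi : Measurable fun p : (ℕ → ℝ) × (ℕ → Fin k → ℝ) => p.1 i • p.2 i := by fun_prop
    exact hi hR
  have h1 : P {ω | ∀ i < n, ζ i ω • V i ω ∉ R} =
      P.map (fun ω => ((fun i => ζ i ω), fun i => V i ω)) S := by
    rw [Measure.map_apply (hζ.prodMk hV) hSm]
    rfl
  rw [h1, h.map_prod, Measure.prod_apply hSm, lintegral_map (measurable_measure_prodMk_left hSm) hζ]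
  refine lintegral_congr fun ω => ?_
  have h2 : Prod.mk (fun i => ζ i ω) ⁻¹' S =
      Set.pi (Finset.range n : Set ℕ) fun i => {v | ζ i ω • v ∈ R}ᶜ := by
    ext p
    simp [hS, Set.mem_pi]
  rw [h2, Measure.infinitePi_pi _ (fun i _ => (hz _).compl)]
  exact Finset.prod_congr rfl fun i _ => prob_compl_eq_one_sub (hz _)

theorem IsSpectralVector.measurable_mark (h : IsSpectralVector ζ V P) {R : Set (Fin k → ℝ)}
    (hR : MeasurableSet R) : Measurable fun z : ℝ => P.map (V 0) {v | z • v ∈ R} :=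
  have := h.isProbabilityMeasure_map
  measurable_measure_prodMk_left (measurable_smul_vector k hR)

/-- Void probabilities of the points `ζ_i V_i`. -/
theorem IsSpectralVector.measure_forall_notMem (h : IsSpectralVector ζ V P) {R : Set (Fin k → ℝ)}
    (hR : MeasurableSet R) (hfin : exponentMeasure (P.map (V 0)) R ≠ ∞) :
    P {ω | ∀ i, ζ i ω • V i ω ∉ R} =
      ENNReal.ofReal (Real.exp (-(exponentMeasure (P.map (V 0)) R).toReal)) := by
  have := h.isProbabilityMeasure_map
  rw [exponentMeasure_apply _ hR] at hfin ⊢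
  rw [← h.poisson.lintegral_iInf_prod (h.measurable_mark hR) (fun z => prob_le_one) hfin,
    lintegral_iInf]
  · simp only [← h.measure_forall_lt hR]
    have hset : {ω | ∀ i, ζ i ω • V i ω ∉ R} = ⋂ n : ℕ, {ω | ∀ i < n, ζ i ω • V i ω ∉ R} := by
      ext ω
      simp only [mem_ofPred_eq, mem_iInter]
      exact ⟨fun H n i _ => H i, fun H i => H (i + 1) i (Nat.lt_succ_self i)⟩
    rw [hset]
    refine Antitone.measure_iInter (fun a b hab ω H i hi => H i (hi.trans_le hab)) (fun n => ?_)
      ⟨0, measure_ne_top _ _⟩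
    have : {ω | ∀ i < n, ζ i ω • V i ω ∉ R} =
        ⋂ i, ⋂ _ : i < n, ((fun ω => ζ i ω • V i ω) ⁻¹' R)ᶜ := by
      ext ω
      simp
    rw [this]
    exact (MeasurableSet.iInter fun i => MeasurableSet.iInter fun _ =>
      (h.measurable_point i hR).compl).nullMeasurableSet
  · exact fun n => Finset.measurable_prod _ fun i _ =>
      measurable_const.sub ((h.measurable_mark hR).comp (h.poisson.measurable i))
  · refine antitone_nat_of_succ_le fun n ω => ?_
    simp only [Finset.prod_range_succ]
    exact mul_le_of_le_one_right' tsub_le_self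
  · simp

theorem IsSpectralVector.measure_mem (h : IsSpectralVector ζ V P) {R : Set (Fin k → ℝ)}
    (hR : MeasurableSet R) (i : ℕ) :
    P {ω | ζ i ω • V i ω ∈ R} = ∫⁻ z, P.map (V 0) {v | z • v ∈ R} ∂(P.map (ζ i)) := by
  have := h.isProbabilityMeasure_map
  have hind : IndepFun (ζ i) (V i) P :=
    h.indep.comp (φ := fun z : ℕ → ℝ => z i) (ψ := fun v : ℕ → Fin k → ℝ => v i) (measurable_pi_apply i)
      (measurable_pi_apply i)
  have h1 : P {ω | ζ i ω • V i ω ∈ R} =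
      P.map (fun ω => (ζ i ω, V i ω)) ((fun p : ℝ × (Fin k → ℝ) => p.1 • p.2) ⁻¹' R) := by
    rw [Measure.map_apply ((h.poisson.measurable i).prodMk (h.measurable i))
      (measurable_smul_vector k hR)]
    rfl
  rw [h1, (indepFun_iff_map_prod_eq_prod_map_map (h.poisson.measurable i).aemeasurable
    (h.measurable i).aemeasurable).1 hind, (h.identDistrib i).map_eq,
    Measure.prod_apply (measurable_smul_vector k hR)]
  rfl

/-- The intensity of the points `ζ_i V_i`. -/
theorem IsSpectralVector.tsum_measure_mem (h : IsSpectralVector ζ V P) {R : Set (Fin k → ℝ)}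
    (hR : MeasurableSet R) :
    ∑' i, P {ω | ζ i ω • V i ω ∈ R} = exponentMeasure (P.map (V 0)) R := by
  have := h.isProbabilityMeasure_map
  simp only [h.measure_mem hR]
  rw [exponentMeasure_apply _ hR, ← lintegral_sum_measure, h.poisson.sum_map]

/-- With `l` the mean number of points in `R`, the mean and the avoidance probability bound the
chance of two points by `l - (1 - exp (-l))`, and `exp (-l) ≤ 1 / (1 + l)` turns this into `l ^ 2`.
Joint independence of counts of the marked process is never needed. -/
theorem IsSpectralVector.measure_exists_ne_le (h : IsSpectralVector ζ V P) {R : Set (Fin k → ℝ)}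
    (hR : MeasurableSet R) (hfin : exponentMeasure (P.map (V 0)) R ≠ ∞) :
    P.real {ω | ∃ i i', i ≠ i' ∧ ζ i ω • V i ω ∈ R ∧ ζ i' ω • V i' ω ∈ R} ≤
      (exponentMeasure (P.map (V 0)) R).toReal ^ 2 := by
  set l := (exponentMeasure (P.map (V 0)) R).toReal with hl
  have hl0 : 0 ≤ l := ENNReal.toReal_nonneg
  have h1 := measure_exists_ne_add_le (P := P) (E := fun i => {ω | ζ i ω • V i ω ∈ R})
    (fun i => h.measurable_point i hR)
  rw [h.tsum_measure_mem hR] at h1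
  have h2 := ENNReal.toReal_mono hfin h1
  rw [ENNReal.toReal_add (measure_ne_top _ _) (measure_ne_top _ _)] at h2
  have hU : MeasurableSet {ω | ∃ i, ζ i ω • V i ω ∈ R} := by
    have : {ω | ∃ i, ζ i ω • V i ω ∈ R} = ⋃ i, (fun ω => ζ i ω • V i ω) ⁻¹' R := by ext; simp
    rw [this]
    exact MeasurableSet.iUnion fun i => h.measurable_point i hR
  have h3 : P.real {ω | ∃ i, ζ i ω • V i ω ∈ R} = 1 - Real.exp (-l) := by
    have hc : {ω | ∃ i, ζ i ω • V i ω ∈ R}ᶜ = {ω | ∀ i, ζ i ω • V i ω ∉ R} := by ext; simp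
    have := probReal_compl_eq_one_sub (μ := P) hU
    rw [hc, measureReal_def, h.measure_forall_notMem hR hfin,
      ENNReal.toReal_ofReal (Real.exp_pos _).le] at this
    linarith
  have h4 : Real.exp (-l) ≤ 1 / (1 + l) := by
    rw [Real.exp_neg, ← one_div]
    exact one_div_le_one_div_of_le (by positivity) (by linarith [Real.add_one_le_exp l])
  have h5 : l - 1 + 1 / (1 + l) ≤ l ^ 2 := by
    have : l - 1 + 1 / (1 + l) = l ^ 2 / (1 + l) := by field_simp; ring
    rw [this]
    exact div_le_self (sq_nonneg l) (by linarith)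
  have h6 : P.real {ω | ∃ i i', i ≠ i' ∧ ζ i ω • V i ω ∈ R ∧ ζ i' ω • V i' ω ∈ R} +
      P.real {ω | ∃ i, ζ i ω • V i ω ∈ R} ≤ l := h2
  linarith

/-- Fubini with the vector `v` held fixed: the `z` with `x < z * v j` have mass `v j / x`, and the
unit mean leaves `1 / x`. -/
theorem IsSpectralVector.exponentMeasure_lt (h : IsSpectralVector ζ V P) (j : Fin k) {x : ℝ}
    (hx : 0 < x) :
    exponentMeasure (P.map (V 0)) {y | x < y j} = ENNReal.ofReal (1 / x) := by
  have := h.isProbabilityMeasure_map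
  have hR : MeasurableSet {y : Fin k → ℝ | x < y j} :=
    measurableSet_lt measurable_const (measurable_pi_apply j)
  rw [exponentMeasure, Measure.map_apply (measurable_smul_vector k) hR,
    Measure.prod_apply_symm (measurable_smul_vector k hR),
    lintegral_map (measurable_measure_prodMk_right (measurable_smul_vector k hR)) (h.measurable 0)]
  have h1 : ∀ ω, invSqIntensity ((fun z => (z, V 0 ω)) ⁻¹'
      ((fun p : ℝ × (Fin k → ℝ) => p.1 • p.2) ⁻¹' {y | x < y j})) =
      ENNReal.ofReal (V 0 ω j * (1 / x)) := fun ω => by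
    rcases (h.nonneg 0 ω j).eq_or_lt with h0 | h0
    · have : (fun z => (z, V 0 ω)) ⁻¹'
          ((fun p : ℝ × (Fin k → ℝ) => p.1 • p.2) ⁻¹' {y | x < y j}) = ∅ := by
        ext z
        simp [← h0, hx.le]
      rw [this, ← h0]
      simp
    · have : (fun z => (z, V 0 ω)) ⁻¹'
          ((fun p : ℝ × (Fin k → ℝ) => p.1 • p.2) ⁻¹' {y | x < y j}) = Ioi (x / V 0 ω j) := by
        ext z
        simp [div_lt_iff₀ h0]
      rw [this, invSqIntensity_Ioi (by positivity)]
      congr 1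
      field_simp
  simp only [h1]
  have hint : Integrable (fun ω => V 0 ω j) P := by
    by_contra hc
    have := h.mean_eq_one j
    rw [integral_undef hc] at this
    exact zero_ne_one this
  rw [← ofReal_integral_eq_lintegral_ofReal (hint.mul_const _)
    (ae_of_all _ fun ω => mul_nonneg (h.nonneg 0 ω j) (by positivity)), integral_mul_const,
    h.mean_eq_one, one_mul]

end SpectralVector

/-! ### Rounding to a grid -/

/-- Level of `y` on a grid with `L` points `ρ / L < … < ρ / 2 < ρ / 1`: the number of grid points
below `y`. -/
noncomputable def gridLevel (L : ℕ) (ρ y : ℝ) : Fin (L + 1) :=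
  ⟨if 0 < y then L - ⌊ρ / y⌋₊ else 0, by split <;> omega⟩

/-- The thresholds are reciprocals of equally spaced numbers because `Λ {y | x < y j} = 1 / x`: all
positive levels, including the unbounded top one, then have the same mass. Level `L` has no upper
threshold, hence the condition `a < L`. -/
theorem gridLevel_le_iff {L : ℕ} {ρ : ℝ} (hρ : 0 < ρ) {a : Fin (L + 1)} (ha : (a : ℕ) < L) (y : ℝ) :
    gridLevel L ρ y ≤ a ↔ y ≤ ρ / ((L : ℝ) - a) := by
  have hpos : (0 : ℝ) < (L : ℝ) - a := sub_pos.2 (by exact_mod_cast ha)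
  rw [Fin.le_def, gridLevel]
  by_cases hy : 0 < y
  · simp only [hy, if_true]
    have hd : 0 ≤ ρ / y := by positivity
    rw [tsub_le_iff_left, ← tsub_le_iff_right, Nat.le_floor_iff hd, Nat.cast_sub ha.le,
      le_div_iff₀ hy, le_div_iff₀ hpos, mul_comm]
  · simp only [hy, if_false, Nat.zero_le, true_iff]
    exact (not_lt.1 hy).trans (by positivity)

theorem gridLevel_mono {L : ℕ} {ρ : ℝ} (hρ : 0 < ρ) : Monotone (gridLevel L ρ) := fun y y' hyy => by
  by_cases ha : (gridLevel L ρ y' : ℕ) < L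
  · rw [gridLevel_le_iff hρ ha]
    exact hyy.trans ((gridLevel_le_iff hρ ha y').1 le_rfl)
  · rw [Fin.le_def]
    have := (gridLevel L ρ y).is_lt
    omega

theorem measurable_gridLevel {L : ℕ} {ρ : ℝ} (hρ : 0 < ρ) : Measurable (gridLevel L ρ) :=
  (gridLevel_mono hρ).measurable

/-- Levels of all the coordinates of a vector. -/
noncomputable def gridCell {k : ℕ} (L : ℕ) (ρ : ℝ) (y : Fin k → ℝ) : Fin k → Fin (L + 1) :=
  fun j => gridLevel L ρ (y j)

theorem measurable_gridCell {k L : ℕ} {ρ : ℝ} (hρ : 0 < ρ) :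
    Measurable (gridCell (k := k) L ρ) :=
  measurable_pi_lambda _ fun j => (measurable_gridLevel hρ).comp (measurable_pi_apply j)

/-- The nonzero cells that contain a point. -/
def occupiedCells {ι : Type*} {k L : ℕ} (c : ι → Fin k → Fin (L + 1)) : Set (Fin k → Fin (L + 1)) :=
  {x | x ≠ 0 ∧ ∃ i, c i = x}

theorem hittingScenario_congr {ι ι' : Type*} {k : ℕ} {ψ : ι → Fin k → ℝ} {ψ' : ι' → Fin k → ℝ}
    (h : ∀ j₁ j₂, (argMax fun i => ψ i j₁) = (argMax fun i => ψ i j₂) ↔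
      (argMax fun i => ψ' i j₁) = (argMax fun i => ψ' i j₂)) :
    hittingScenario ψ = hittingScenario ψ' := by
  have : sameArgMax ψ = sameArgMax ψ' := Setoid.ext fun j₁ j₂ => h j₁ j₂
  unfold hittingScenario
  congr

theorem argMax_eq_singleton {ι : Type*} {u : ι → ℝ} {i : ι} (h : ∀ i', i' ≠ i → u i' < u i) :
    argMax u = {i} := by
  ext i'
  simp only [argMax, mem_ofPred_eq, mem_singleton_iff]
  refine ⟨fun H => ?_, ?_⟩
  · by_contra hne
    exact (h i' hne).not_ge (H i)
  · rintro rfl i''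
    rcases eq_or_ne i'' i' with rfl | hne
    · exact le_rfl
    · exact (h i'' hne).le

/-- The hitting scenario defined by the occupied cells. -/
noncomputable def cellScenario {k L : ℕ} (O : Set (Fin k → Fin (L + 1))) : Partitions k :=
  hittingScenario fun (c : O) j => ((c.1 j : ℕ) : ℝ)

/-- The configuration can be read off from the occupied cells: each coordinate has a point of
positive level, and no two points have the same positive level in some coordinate. -/
def IsSeparated {ι : Type*} {k L : ℕ} (c : ι → Fin k → Fin (L + 1)) : Prop :=
  (∀ j, ∃ i, c i j ≠ 0) ∧ ∀ j l, l ≠ 0 → ¬ ∃ i i', i ≠ i' ∧ c i j = l ∧ c i' j = l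

/-- The highest level in a coordinate is positive and reached by one point only; as levels are
monotone in the value, that point is the unique maximizer. Among occupied cells the maximizer is the
cell of this point. -/
theorem IsSeparated.hittingScenario_eq {ι : Type*} {k L : ℕ} {ρ : ℝ} (hρ : 0 < ρ)
    {ψ : ι → Fin k → ℝ} (h : IsSeparated fun i => gridCell L ρ (ψ i)) :
    hittingScenario ψ = cellScenario (occupiedCells fun i => gridCell L ρ (ψ i)) := by
  set c := fun i => gridCell L ρ (ψ i) with hc
  have hex : ∀ j, ∃ i, c i j ≠ 0 ∧ ∀ i', i' ≠ i → c i' j < c i j := fun j => by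
    obtain ⟨i₀, hi₀⟩ := h.1 j
    -- The index set may be infinite, but there are only finitely many levels.
    obtain ⟨_, ⟨i, rfl⟩, hmax⟩ :=
      (Set.toFinite (range fun i => c i j)).exists_maximal ⟨_, i₀, rfl⟩
    have hle : ∀ i', c i' j ≤ c i j := fun i' =>
      (le_total (c i' j) (c i j)).elim id fun hle => hmax ⟨i', rfl⟩ hle
    have h0 : c i j ≠ 0 := fun h0 => hi₀ (Fin.le_zero_iff.1 (h0 ▸ hle i₀))
    refine ⟨i, h0, fun i' hne => lt_of_le_of_ne (hle i') fun heq => ?_⟩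
    exact h.2 j (c i j) h0 ⟨i', i, hne, heq, rfl⟩
  choose m hm0 hm using hex
  have hψ : ∀ j, (argMax fun i => ψ i j) = {m j} := fun j =>
    argMax_eq_singleton fun i' hne => by
      by_contra hle
      exact (hm j i' hne).not_ge (gridLevel_mono hρ (not_lt.1 hle))
  have hmem : ∀ j, c (m j) ∈ occupiedCells c := fun j =>
    ⟨fun h0 => hm0 j (by rw [h0]; rfl), m j, rfl⟩
  have hO : ∀ j, (argMax fun x : occupiedCells c => ((x.1 j : ℕ) : ℝ)) = {⟨c (m j), hmem j⟩} :=
    fun j => argMax_eq_singleton fun x hne => by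
      obtain ⟨x, hx0, i, rfl⟩ := x
      have hi : i ≠ m j := fun hi => hne (Subtype.ext (congrArg c hi))
      exact_mod_cast hm j i hi
  refine hittingScenario_congr fun j₁ j₂ => ?_
  rw [hψ, hψ, hO, hO, singleton_eq_singleton_iff, singleton_eq_singleton_iff, Subtype.mk.injEq]
  refine ⟨fun H => by rw [H], fun H => ?_⟩
  -- Two maximizers in the same cell would share a positive level in coordinate `j₁`.
  by_contra hne
  exact h.2 j₁ _ (hm0 j₁) ⟨m j₁, m j₂, hne, rfl, by rw [H]⟩

/-! ### Two limit lemmas, and convergence in law of finite random sets -/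

/-- Squeeze by `u * (-log u) ≤ 1 - u ≤ -log u`, multiplied by `n`. The upper bound also forces `u n
→ 1`, which makes the lower one sharp. -/
theorem tendsto_mul_one_sub_of_tendsto_pow {u : ℕ → ℝ} {v : ℝ} (h0 : ∀ n, 0 ≤ u n)
    (h1 : ∀ n, u n ≤ 1) (h : Tendsto (fun n => u n ^ n) atTop (𝓝 (Real.exp (-v)))) :
    Tendsto (fun n => n * (1 - u n)) atTop (𝓝 v) := by
  have hlog : Tendsto (fun n => -Real.log (u n ^ n)) atTop (𝓝 v) := by
    simpa using (h.log (Real.exp_pos _).ne').neg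
  have hpos : ∀ᶠ n in atTop, 0 < u n := by
    filter_upwards [h.eventually (lt_mem_nhds (Real.exp_pos (-v))), eventually_ge_atTop 1]
      with n hn hn1
    refine (h0 n).lt_of_ne fun h => ?_
    rw [← h, zero_pow (by omega)] at hn
    exact hn.false
  have hupper : ∀ᶠ n in atTop, n * (1 - u n) ≤ -Real.log (u n ^ n) := by
    filter_upwards [hpos] with n hn
    rw [Real.log_pow, ← mul_neg]
    exact mul_le_mul_of_nonneg_left (by linarith [Real.log_le_sub_one_of_pos hn]) n.cast_nonneg
  have hu : Tendsto u atTop (𝓝 1) := by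
    have hb : Tendsto (fun n => 1 - -Real.log (u n ^ n) / n) atTop (𝓝 (1 - 0)) :=
      tendsto_const_nhds.sub (hlog.div_atTop tendsto_natCast_atTop_atTop)
    rw [sub_zero] at hb
    refine tendsto_of_tendsto_of_tendsto_of_le_of_le' hb tendsto_const_nhds ?_
      (Eventually.of_forall h1)
    filter_upwards [hupper, eventually_ge_atTop 1] with n hn hn1
    have hn' : (0 : ℝ) < n := by exact_mod_cast hn1
    have : 1 - u n ≤ -Real.log (u n ^ n) / n := by
      rw [le_div_iff₀ hn']
      linarith
    linarith
  have hlower : ∀ᶠ n in atTop, u n * -Real.log (u n ^ n) ≤ n * (1 - u n) := by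
    filter_upwards [hpos] with n hn
    have h2 := Real.one_sub_inv_le_log_of_pos hn
    have h3 : u n * -Real.log (u n) ≤ 1 - u n := by
      have := mul_le_mul_of_nonneg_left h2 hn.le
      rw [mul_sub, mul_inv_cancel₀ hn.ne'] at this
      linarith
    rw [Real.log_pow]
    have := mul_le_mul_of_nonneg_left h3 (n.cast_nonneg (α := ℝ))
    linarith
  have hlow : Tendsto (fun n => u n * -Real.log (u n ^ n)) atTop (𝓝 v) := by
    simpa using hu.mul hlog
  exact tendsto_of_tendsto_of_tendsto_of_le_of_le' hlow hlog hlower hupper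

/-- Möbius inversion on a finite poset, by well-founded induction: the value at `a` is the sum up to
`a` minus values strictly below it. -/
theorem tendsto_of_tendsto_sum_le {C : Type*} [Fintype C] [PartialOrder C] [DecidableLE C]
    {f : ℕ → C → ℝ} {g : C → ℝ}
    (h : ∀ a, Tendsto (fun n => ∑ x with x ≤ a, f n x) atTop (𝓝 (∑ x with x ≤ a, g x))) (a : C) :
    Tendsto (fun n => f n a) atTop (𝓝 (g a)) := by
  classical
  induction a using WellFoundedLT.induction with
  | ind a ih =>
    have hs : ∀ F : C → ℝ, F a = ∑ x with x ≤ a, F x - ∑ x with x < a, F x := fun F => by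
      have : (Finset.univ.filter fun x => x ≤ a) = insert a (Finset.univ.filter fun x => x < a) := by
        ext x
        simp [le_iff_eq_or_lt]
      rw [this, Finset.sum_insert (by simp)]
      ring
    simp only [fun n => hs (f n)]
    rw [hs g]
    exact (h a).sub (tendsto_finsetSum _ fun x hx => ih x (Finset.mem_filter.1 hx).2)

section RandomSets

variable {Ω Ω' C : Type*} [MeasurableSpace Ω] [MeasurableSpace Ω']
  {P : Measure Ω} {P' : Measure Ω'}

theorem measureReal_disjoint_insert_subset [DecidableEq C] [IsProbabilityMeasure P] {U : Ω → Set C}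
    (hU : ∀ c, MeasurableSet {ω | c ∈ U ω}) (a : C) (S R : Finset C) :
    P.real {ω | (∀ c ∈ R, c ∉ U ω) ∧ ∀ c ∈ insert a S, c ∈ U ω} =
      P.real {ω | (∀ c ∈ R, c ∉ U ω) ∧ ∀ c ∈ S, c ∈ U ω} -
      P.real {ω | (∀ c ∈ insert a R, c ∉ U ω) ∧ ∀ c ∈ S, c ∈ U ω} := by
  rw [eq_sub_iff_add_eq, ← measureReal_inter_add_sdiff
    (s := {ω | (∀ c ∈ R, c ∉ U ω) ∧ ∀ c ∈ S, c ∈ U ω}) (hU a)]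
  congr 2
  · ext ω
    simp only [Finset.mem_insert, forall_eq_or_imp, mem_ofPred_eq, mem_inter_iff]
    tauto
  · ext ω
    simp only [Finset.mem_insert, forall_eq_or_imp, mem_ofPred_eq, Set.mem_sdiff]
    tauto

variable [IsProbabilityMeasure P] [IsProbabilityMeasure P']

/-- Inclusion–exclusion: requiring one more element to be hit is a difference of two events that
require fewer hits, so avoidance probabilities determine everything. -/
theorem tendsto_measureReal_disjoint_subset {O : ℕ → Ω → Set C} {O' : Ω' → Set C}
    (hO : ∀ n c, MeasurableSet {ω | c ∈ O n ω}) (hO' : ∀ c, MeasurableSet {ω | c ∈ O' ω})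
    (h : ∀ R : Finset C, Tendsto (fun n => P.real {ω | ∀ c ∈ R, c ∉ O n ω}) atTop
      (𝓝 (P'.real {ω | ∀ c ∈ R, c ∉ O' ω}))) (S R : Finset C) :
    Tendsto (fun n => P.real {ω | (∀ c ∈ R, c ∉ O n ω) ∧ ∀ c ∈ S, c ∈ O n ω}) atTop
      (𝓝 (P'.real {ω | (∀ c ∈ R, c ∉ O' ω) ∧ ∀ c ∈ S, c ∈ O' ω})) := by
  classical
  induction S using Finset.induction_on generalizing R with
  | empty => simpa using h R
  | insert a S _ ih =>
    rw [measureReal_disjoint_insert_subset hO' a S R]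
    simp only [fun n => measureReal_disjoint_insert_subset (P := P) (hO n) a S R]
    exact (ih R).sub (ih (insert a R))

variable [Finite C]

theorem measureReal_comp_eq_sum [Fintype (Set C)] {β : Type*} [DecidableEq β] {U : Ω → Set C}
    (hU : ∀ c, MeasurableSet {ω | c ∈ U ω}) (F : Set C → β) (b : β) :
    P.real {ω | F (U ω) = b} = ∑ S : Set C with F S = b, P.real {ω | U ω = S} := by
  have hm : ∀ S, MeasurableSet {ω | U ω = S} := fun S => by
    have : {ω | U ω = S} = ⋂ c, {ω | c ∈ U ω ↔ c ∈ S} := by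
      ext ω
      simp [Set.ext_iff]
    rw [this]
    exact MeasurableSet.iInter fun c => (hU c).iff (MeasurableSet.const _)
  rw [← measureReal_biUnion_finset _ (fun S _ => hm S)]
  · congr 1
    ext ω
    simp
  · intro S _ S' _ hne
    exact disjoint_left.2 fun ω (h1 : U ω = S) (h2 : U ω = S') => hne (h1.symm.trans h2)

theorem tendsto_measureReal_eq {O : ℕ → Ω → Set C} {O' : Ω' → Set C}
    (hO : ∀ n c, MeasurableSet {ω | c ∈ O n ω}) (hO' : ∀ c, MeasurableSet {ω | c ∈ O' ω})
    (h : ∀ R : Finset C, Tendsto (fun n => P.real {ω | ∀ c ∈ R, c ∉ O n ω}) atTop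
      (𝓝 (P'.real {ω | ∀ c ∈ R, c ∉ O' ω}))) (S : Set C) :
    Tendsto (fun n => P.real {ω | O n ω = S}) atTop (𝓝 (P'.real {ω | O' ω = S})) := by
  have hS := Set.toFinite S
  have hSc := Set.toFinite Sᶜ
  have := tendsto_measureReal_disjoint_subset hO hO' h hS.toFinset hSc.toFinset
  have heq : ∀ U : Set C, ((∀ c ∈ hSc.toFinset, c ∉ U) ∧ ∀ c ∈ hS.toFinset, c ∈ U) ↔ U = S :=
    fun U => by
      simp only [Finite.mem_toFinset, mem_compl_iff]
      refine ⟨fun H => Subset.antisymm (fun c hc => ?_) H.2, ?_⟩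
      · by_contra hcS
        exact H.1 c hcS hc
      · rintro rfl
        exact ⟨fun _ => id, fun _ => id⟩
  simpa only [heq] using this

theorem tendsto_measureReal_comp {β : Type*} {O : ℕ → Ω → Set C} {O' : Ω' → Set C}
    (hO : ∀ n c, MeasurableSet {ω | c ∈ O n ω}) (hO' : ∀ c, MeasurableSet {ω | c ∈ O' ω})
    (h : ∀ R : Finset C, Tendsto (fun n => P.real {ω | ∀ c ∈ R, c ∉ O n ω}) atTop
      (𝓝 (P'.real {ω | ∀ c ∈ R, c ∉ O' ω}))) (F : Set C → β) (b : β) :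
    Tendsto (fun n => P.real {ω | F (O n ω) = b}) atTop (𝓝 (P'.real {ω | F (O' ω) = b})) := by
  classical
  have := Fintype.ofFinite (Set C)
  rw [measureReal_comp_eq_sum hO' F b]
  simp only [fun n => measureReal_comp_eq_sum (P := P) (hO n) F b]
  exact tendsto_finsetSum _ fun S _ => tendsto_measureReal_eq hO hO' h S

end RandomSets

/-! ### Independent rows -/

/-- A triangular array whose rows consist of independent copies of one random element. -/
structure IsIIDArray {Ω E : Type*} [MeasurableSpace Ω] [MeasurableSpace E]
    (W : ℕ → ℕ → Ω → E) (P : Measure Ω) : Prop where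
  measurable : ∀ n i, Measurable (W n i)
  iIndep : ∀ n, iIndepFun (W n) P
  identDistrib : ∀ n i, IdentDistrib (W n i) (W n 0) P P

theorem measureReal_mem_finset {Ω C : Type*} [MeasurableSpace Ω] {μ : Measure Ω} {f : Ω → C}
    (T : Finset C) (hf : ∀ c ∈ T, MeasurableSet {ω | f ω = c})
    (hfin : ∀ c ∈ T, μ {ω | f ω = c} ≠ ∞) :
    μ.real {ω | f ω ∈ T} = ∑ c ∈ T, μ.real {ω | f ω = c} :=
  (sum_measureReal_preimage_singleton T hf hfin).symm

section Array

variable {Ω E : Type*} [MeasurableSpace Ω] [MeasurableSpace E]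
  {P : Measure Ω} {W : ℕ → ℕ → Ω → E}

theorem IsIIDArray.measureReal_mem (h : IsIIDArray W P) {A : Set E} (hA : MeasurableSet A)
    (n i : ℕ) : P.real {ω | W n i ω ∈ A} = P.real {ω | W n 0 ω ∈ A} :=
  congrArg ENNReal.toReal ((h.identDistrib n i).measure_mem_eq hA)

theorem IsIIDArray.measureReal_forall (h : IsIIDArray W P) {A : Set E} (hA : MeasurableSet A)
    (n : ℕ) : P.real {ω | ∀ i : Fin n, W n i ω ∈ A} = P.real {ω | W n 0 ω ∈ A} ^ n := by
  have h1 : {ω | ∀ i : Fin n, W n i ω ∈ A} = ⋂ i ∈ Finset.range n, W n i ⁻¹' A := by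
    ext ω
    simp only [mem_ofPred_eq, Finset.mem_range, mem_iInter, mem_preimage]
    exact ⟨fun H i hi => H ⟨i, hi⟩, fun H i => H i i.2⟩
  rw [h1, measureReal_def,
    (h.iIndep n).measure_inter_preimage_eq_mul (Finset.range n) (fun _ _ => hA),
    ENNReal.toReal_prod,
    Finset.prod_congr rfl (f := fun i => (P (W n i ⁻¹' A)).toReal)
      (g := fun _ => P.real {ω | W n 0 ω ∈ A}) (fun i _ => h.measureReal_mem hA n i), Finset.prod_const, Finset.card_range]

variable [IsProbabilityMeasure P]

theorem IsIIDArray.measureReal_exists_ne_le (h : IsIIDArray W P) {A : Set E}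
    (hA : MeasurableSet A) (n : ℕ) :
    P.real {ω | ∃ i i' : Fin n, i ≠ i' ∧ W n i ω ∈ A ∧ W n i' ω ∈ A} ≤
      (n * P.real {ω | W n 0 ω ∈ A}) ^ 2 := by
  classical
  set p := P.real {ω | W n 0 ω ∈ A} with hp
  have h1 : {ω | ∃ i i' : Fin n, i ≠ i' ∧ W n i ω ∈ A ∧ W n i' ω ∈ A} ⊆
      ⋃ q ∈ (Finset.univ : Finset (Fin n × Fin n)).filter (fun q => q.1 ≠ q.2),
        {ω | W n q.1 ω ∈ A ∧ W n q.2 ω ∈ A} := by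
    rintro ω ⟨i, i', hne, hi, hi'⟩
    simp only [mem_iUnion]
    exact ⟨(i, i'), by simpa using hne, hi, hi'⟩
  refine (measureReal_mono h1 (measure_ne_top _ _)).trans ((measureReal_biUnion_finset_le _ _).trans ?_)
  have h2 : ∀ q ∈ (Finset.univ : Finset (Fin n × Fin n)).filter (fun q => q.1 ≠ q.2),
      P.real {ω | W n q.1 ω ∈ A ∧ W n q.2 ω ∈ A} = p ^ 2 := fun q hq => by
    have hne : (q.1 : ℕ) ≠ q.2 := fun h => (Finset.mem_filter.1 hq).2 (Fin.ext h)
    have hi := ((h.iIndep n).indepFun hne).measure_inter_preimage_eq_mul A A hA hA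
    have h3 := congrArg ENNReal.toReal hi
    rw [ENNReal.toReal_mul] at h3
    refine h3.trans ?_
    rw [sq, hp]
    exact congrArg₂ _ (h.measureReal_mem hA n _) (h.measureReal_mem hA n _)
  rw [Finset.sum_congr rfl h2, Finset.sum_const, nsmul_eq_mul, mul_pow]
  refine mul_le_mul_of_nonneg_right ?_ (sq_nonneg p)
  have h4 : ((Finset.univ : Finset (Fin n × Fin n)).filter (fun q => q.1 ≠ q.2)).card ≤ n ^ 2 := by
    refine (Finset.card_filter_le _ _).trans ?_
    simp [sq]
  exact_mod_cast h4

end Array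

/-! ### Intensities of levels and cells -/

section Intensity

variable {Ω : Type*} [MeasurableSpace Ω] {P : Measure Ω} [IsProbabilityMeasure P] {k : ℕ}
  {ζ : ℕ → Ω → ℝ} {V : ℕ → Ω → Fin k → ℝ} {L : ℕ} {ρ : ℝ}

theorem IsSpectralVector.exponentMeasure_lt_gridLevel (h : IsSpectralVector ζ V P) (hρ : 0 < ρ)
    (j : Fin k) (a : Fin (L + 1)) :
    exponentMeasure (P.map (V 0)) {y | a < gridLevel L ρ (y j)} =
      ENNReal.ofReal (((L : ℝ) - a) / ρ) := by
  by_cases ha : (a : ℕ) < L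
  · have hpos : (0 : ℝ) < (L : ℝ) - a := sub_pos.2 (by exact_mod_cast ha)
    simp only [← not_le, gridLevel_le_iff hρ ha]
    simp only [not_le]
    rw [h.exponentMeasure_lt j (by positivity), one_div_div]
  · have haL : (a : ℕ) = L := by have := a.is_lt; omega
    have : {y : Fin k → ℝ | a < gridLevel L ρ (y j)} = ∅ := by
      ext y
      simp only [mem_ofPred_eq, mem_empty_iff_false, iff_false, not_lt, Fin.le_def, haL]
      exact Nat.lt_succ_iff.1 (gridLevel L ρ (y j)).is_lt
    rw [this, haL]
    simp

theorem measurableSet_gridLevel (hρ : 0 < ρ) (j : Fin k) (S : Set (Fin (L + 1))) :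
    MeasurableSet {y : Fin k → ℝ | gridLevel L ρ (y j) ∈ S} :=
  ((measurable_gridLevel hρ).comp (measurable_pi_apply j)) (MeasurableSet.of_discrete (s := S))

theorem measurableSet_gridCell (hρ : 0 < ρ) (S : Set (Fin k → Fin (L + 1))) :
    MeasurableSet {y : Fin k → ℝ | gridCell L ρ y ∈ S} :=
  (measurable_gridCell hρ) (Set.toFinite S).measurableSet

theorem IsSpectralVector.exponentMeasure_gridLevel_eq (h : IsSpectralVector ζ V P) (hρ : 0 < ρ)
    (j : Fin k) {l : Fin (L + 1)} (hl : l ≠ 0) :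
    (exponentMeasure (P.map (V 0))).real {y | gridLevel L ρ (y j) = l} = 1 / ρ := by
  have hl' : (l : ℕ) ≠ 0 := fun h => hl (Fin.ext h)
  have hlt := l.is_lt
  let a : Fin (L + 1) := ⟨l - 1, by omega⟩
  have hset : {y : Fin k → ℝ | gridLevel L ρ (y j) = l} =
      {y | a < gridLevel L ρ (y j)} \ {y | l < gridLevel L ρ (y j)} := by
    ext y
    simp only [mem_ofPred_eq, Set.mem_sdiff, Fin.lt_def, Fin.ext_iff, a]
    omega
  have hsub : {y : Fin k → ℝ | l < gridLevel L ρ (y j)} ⊆ {y | a < gridLevel L ρ (y j)} :=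
    fun y hy => by
      simp only [mem_ofPred_eq, Fin.lt_def, a] at hy ⊢
      omega
  have hfin : exponentMeasure (P.map (V 0)) {y | a < gridLevel L ρ (y j)} ≠ ∞ := by
    rw [h.exponentMeasure_lt_gridLevel hρ]
    exact ENNReal.ofReal_ne_top
  rw [hset, measureReal_sdiff hsub (measurableSet_gridLevel hρ j (Ioi l)) hfin,
    measureReal_def, measureReal_def, h.exponentMeasure_lt_gridLevel hρ,
    h.exponentMeasure_lt_gridLevel hρ, ENNReal.toReal_ofReal, ENNReal.toReal_ofReal]
  · have ha : ((a : ℕ) : ℝ) = l - 1 := by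
      simp only [a]
      rw [Nat.cast_sub (by omega), Nat.cast_one]
    rw [ha]
    ring
  · exact div_nonneg (sub_nonneg.2 (by exact_mod_cast Nat.lt_succ_iff.1 hlt)) hρ.le
  · exact div_nonneg (sub_nonneg.2 (by exact_mod_cast Nat.lt_succ_iff.1 a.is_lt)) hρ.le

theorem IsSpectralVector.exponentMeasure_gridCell_ne_zero (h : IsSpectralVector ζ V P)
    (hρ : 0 < ρ) :
    exponentMeasure (P.map (V 0)) {y | gridCell L ρ y ≠ 0} ≠ ∞ := by
  have hsub : {y : Fin k → ℝ | gridCell L ρ y ≠ 0} ⊆ ⋃ j, {y | 0 < gridLevel L ρ (y j)} :=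
    fun y hy => by
      obtain ⟨j, hj⟩ := Function.ne_iff.1 hy
      exact mem_iUnion.2 ⟨j, Fin.pos_iff_ne_zero.2 hj⟩
  refine ne_top_of_le_ne_top ?_ ((measure_mono hsub).trans (measure_iUnion_fintype_le _ _))
  simp only [h.exponentMeasure_lt_gridLevel hρ]
  exact ENNReal.sum_ne_top.2 fun _ _ => ENNReal.ofReal_ne_top

/-- The cell 0 is excluded throughout because infinitely much intensity accumulates there. -/
theorem IsSpectralVector.exponentMeasure_gridCell_mem (h : IsSpectralVector ζ V P)
    (hρ : 0 < ρ) {S : Set (Fin k → Fin (L + 1))} (hS : 0 ∉ S) :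
    exponentMeasure (P.map (V 0)) {y | gridCell L ρ y ∈ S} ≠ ∞ :=
  ne_top_of_le_ne_top (h.exponentMeasure_gridCell_ne_zero hρ)
    (measure_mono fun y hy h0 => hS (by rwa [mem_ofPred_eq, h0] at hy))

theorem IsSpectralVector.measureReal_forall_gridCell_notMem (h : IsSpectralVector ζ V P)
    (hρ : 0 < ρ) {S : Set (Fin k → Fin (L + 1))} (hS : 0 ∉ S) :
    P.real {ω | ∀ i, gridCell L ρ (ζ i ω • V i ω) ∉ S} =
      Real.exp (-(exponentMeasure (P.map (V 0))).real {y | gridCell L ρ y ∈ S}) := by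
  have := h.measure_forall_notMem (measurableSet_gridCell hρ S)
    (h.exponentMeasure_gridCell_mem hρ hS)
  rw [measureReal_def, measureReal_def]
  exact (congrArg ENNReal.toReal this).trans (ENNReal.toReal_ofReal (Real.exp_pos _).le)

end Intensity

/-! ### From maxima to cell intensities -/

section Convergence

variable {Ω Ω' : Type*} [MeasurableSpace Ω] [MeasurableSpace Ω']
  {P : Measure Ω} {P' : Measure Ω'} [IsProbabilityMeasure P] [IsProbabilityMeasure P'] {k : ℕ}
  {ζ : ℕ → Ω' → ℝ} {V : ℕ → Ω' → Fin k → ℝ} {W : ℕ → ℕ → Ω → Fin k → ℝ} {L : ℕ} {ρ : ℝ}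

/-- By independence the hypothesis is about `P (W ≤ a) ^ n`, so it yields the limit of `n * P (¬ W ≤
a)` on the grid. Subtracting the exceedances of `a` from those of 0 gives sums over nonzero cells
below `a`, and Möbius inversion isolates one cell. -/
theorem tendsto_mul_measureReal_gridCell_eq (hV : IsSpectralVector ζ V P') (hW : IsIIDArray W P)
    (hρ : 0 < ρ)
    (H : ∀ a, Tendsto (fun n => P.real {ω | ∀ i : Fin n, gridCell L ρ (W n i ω) ≤ a}) atTop
      (𝓝 (P'.real {ω | ∀ i, gridCell L ρ (ζ i ω • V i ω) ≤ a})))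
    {c : Fin k → Fin (L + 1)} (hc : c ≠ 0) :
    Tendsto (fun n : ℕ => n * P.real {ω | gridCell L ρ (W n 0 ω) = c}) atTop
      (𝓝 ((exponentMeasure (P'.map (V 0))).real {y | gridCell L ρ y = c})) := by
  classical
  set Λ := exponentMeasure (P'.map (V 0)) with hΛ
  have hcomp : ∀ a, Tendsto (fun n : ℕ => n * P.real {ω | ¬ gridCell L ρ (W n 0 ω) ≤ a}) atTop
      (𝓝 (Λ.real {y | ¬ gridCell L ρ y ≤ a})) := fun a => by
    have h1 := H a
    have h2 := hV.measureReal_forall_gridCell_notMem hρ (S := {x | ¬ x ≤ a})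
      (by simp [Pi.le_def])
    simp only [mem_ofPred_eq, not_not] at h2
    rw [h2] at h1
    have h3 : ∀ n, P.real {ω | ∀ i : Fin n, gridCell L ρ (W n i ω) ≤ a} =
        P.real {ω | gridCell L ρ (W n 0 ω) ≤ a} ^ n := fun n =>
      hW.measureReal_forall (measurableSet_gridCell hρ (Iic a)) n
    simp only [h3] at h1
    have h4 := tendsto_mul_one_sub_of_tendsto_pow (fun n => measureReal_nonneg)
      (fun n => measureReal_le_one) h1
    refine h4.congr fun n => ?_
    congr 1
    exact (probReal_compl_eq_one_sub
      (hW.measurable n 0 (measurableSet_gridCell hρ (Iic a)))).symm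
  -- The value 0 at the cell 0 removes the cell of infinite intensity from the sums.
  let f : ℕ → (Fin k → Fin (L + 1)) → ℝ := fun n x =>
    if x = 0 then 0 else n * P.real {ω | gridCell L ρ (W n 0 ω) = x}
  let g : (Fin k → Fin (L + 1)) → ℝ := fun x => if x = 0 then 0 else Λ.real {y | gridCell L ρ y = x}
  have hfil : ∀ a : Fin k → Fin (L + 1), ((Finset.univ.filter fun x => x ≤ a).filter
      fun x => x ≠ 0 : Finset _) = Finset.univ.filter fun x => x ≤ a ∧ x ≠ 0 := fun a => by
    rw [Finset.filter_filter]
  have hf : ∀ n a, ∑ x with x ≤ a, f n x = n * P.real {ω | ¬ gridCell L ρ (W n 0 ω) ≤ 0} -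
      n * P.real {ω | ¬ gridCell L ρ (W n 0 ω) ≤ a} := fun n a => by
    have hsub : {ω | ¬ gridCell L ρ (W n 0 ω) ≤ a} ⊆ {ω | ¬ gridCell L ρ (W n 0 ω) ≤ 0} :=
      fun ω hω h0 => hω (h0.trans (Pi.le_def.2 fun j => Fin.zero_le _))
    have hm : ∀ S : Set (Fin k → Fin (L + 1)), MeasurableSet {ω | gridCell L ρ (W n 0 ω) ∈ S} :=
      fun S => hW.measurable n 0 (measurableSet_gridCell hρ S)
    rw [← mul_sub, ← measureReal_sdiff hsub (hm {x | ¬ x ≤ a})]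
    simp only [f]
    simp only [← ite_not (p := _ = _)]
    rw [← Finset.sum_filter, hfil, ← Finset.mul_sum, ← measureReal_mem_finset _ (fun x _ => hm {x})
      (fun _ _ => measure_ne_top _ _)]
    congr 2
    ext ω
    have h0 : gridCell L ρ (W n 0 ω) ≤ 0 ↔ gridCell L ρ (W n 0 ω) = 0 :=
      ⟨fun h => le_antisymm h (Pi.le_def.2 fun j => Fin.zero_le _), fun h => h.le⟩
    simp [h0, and_comm]
  have hg : ∀ a, ∑ x with x ≤ a, g x = Λ.real {y | ¬ gridCell L ρ y ≤ 0} -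
      Λ.real {y | ¬ gridCell L ρ y ≤ a} := fun a => by
    have hsub : {y | ¬ gridCell L ρ y ≤ a} ⊆ {y | ¬ gridCell L ρ y ≤ 0} :=
      fun ω hω h0 => hω (h0.trans (Pi.le_def.2 fun j => Fin.zero_le _))
    have hm : ∀ S : Set (Fin k → Fin (L + 1)), MeasurableSet {y | gridCell L ρ y ∈ S} :=
      fun S => measurableSet_gridCell hρ S
    have hfin : ∀ a, Λ {y | ¬ gridCell L ρ y ≤ a} ≠ ∞ := fun a =>
      hV.exponentMeasure_gridCell_mem hρ (S := {x | ¬ x ≤ a}) (by simp [Pi.le_def])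
    rw [← measureReal_sdiff hsub (hm {x | ¬ x ≤ a}) (hfin 0)]
    simp only [g]
    simp only [← ite_not (p := _ = _)]
    rw [← Finset.sum_filter, hfil, ← measureReal_mem_finset _ (fun x _ => hm {x})
      (fun x hx => hV.exponentMeasure_gridCell_mem hρ (S := {x})
        (fun h => (Finset.mem_filter.1 hx).2.2 h.symm))]
    congr 1
    ext y
    have h0 : gridCell L ρ y ≤ 0 ↔ gridCell L ρ y = 0 :=
      ⟨fun h => le_antisymm h (Pi.le_def.2 fun j => Fin.zero_le _), fun h => h.le⟩
    simp [h0, and_comm]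
  have key := tendsto_of_tendsto_sum_le (f := f) (g := g) (fun a => by
    simp only [hf, hg]
    exact (hcomp 0).sub (hcomp a)) c
  simpa only [f, g, hc, if_false] using key

theorem tendsto_mul_measureReal_gridCell_mem (hV : IsSpectralVector ζ V P') (hW : IsIIDArray W P)
    (hρ : 0 < ρ)
    (H : ∀ a, Tendsto (fun n => P.real {ω | ∀ i : Fin n, gridCell L ρ (W n i ω) ≤ a}) atTop
      (𝓝 (P'.real {ω | ∀ i, gridCell L ρ (ζ i ω • V i ω) ≤ a})))
    {S : Set (Fin k → Fin (L + 1))} (hS : 0 ∉ S) :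
    Tendsto (fun n : ℕ => n * P.real {ω | gridCell L ρ (W n 0 ω) ∈ S}) atTop
      (𝓝 ((exponentMeasure (P'.map (V 0))).real {y | gridCell L ρ y ∈ S})) := by
  classical
  have hT := Set.toFinite S
  have h1 : ∀ n, P.real {ω | gridCell L ρ (W n 0 ω) ∈ S} =
      ∑ c ∈ hT.toFinset, P.real {ω | gridCell L ρ (W n 0 ω) = c} := fun n => by
    rw [← measureReal_mem_finset _
      (fun x _ => hW.measurable n 0 (measurableSet_gridCell hρ {x}))
      (fun _ _ => measure_ne_top _ _)]
    simp only [Finite.mem_toFinset]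
  have h2 : (exponentMeasure (P'.map (V 0))).real {y | gridCell L ρ y ∈ S} =
      ∑ c ∈ hT.toFinset, (exponentMeasure (P'.map (V 0))).real {y | gridCell L ρ y = c} := by
    rw [← measureReal_mem_finset _ (fun x _ => measurableSet_gridCell hρ {x})
      (fun x hx => hV.exponentMeasure_gridCell_mem hρ (S := {x})
        (fun h => hS (h ▸ hT.mem_toFinset.1 hx)))]
    simp only [Finite.mem_toFinset]
  rw [h2]
  simp only [h1, Finset.mul_sum]
  refine tendsto_finsetSum _ fun c hc => tendsto_mul_measureReal_gridCell_eq hV hW hρ H ?_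
  rintro rfl
  exact hS (hT.mem_toFinset.1 hc)

/-- The Poisson limit `(1 - p) ^ n → exp (-v)` when `n * p → v`. -/
theorem tendsto_measureReal_forall_gridCell_notMem (hV : IsSpectralVector ζ V P')
    (hW : IsIIDArray W P) (hρ : 0 < ρ)
    (H : ∀ a, Tendsto (fun n => P.real {ω | ∀ i : Fin n, gridCell L ρ (W n i ω) ≤ a}) atTop
      (𝓝 (P'.real {ω | ∀ i, gridCell L ρ (ζ i ω • V i ω) ≤ a})))
    {S : Set (Fin k → Fin (L + 1))} (hS : 0 ∉ S) :
    Tendsto (fun n => P.real {ω | ∀ i : Fin n, gridCell L ρ (W n i ω) ∉ S}) atTop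
      (𝓝 (P'.real {ω | ∀ i, gridCell L ρ (ζ i ω • V i ω) ∉ S})) := by
  rw [hV.measureReal_forall_gridCell_notMem hρ hS]
  have h1 := (tendsto_mul_measureReal_gridCell_mem hV hW hρ H hS).neg
  simp only [← mul_neg] at h1
  refine (Real.tendsto_one_add_pow_exp_of_tendsto h1).congr fun n => ?_
  have h2 := hW.measureReal_forall (measurableSet_gridCell hρ S).compl n
  refine Eq.trans ?_ h2.symm
  congr 1
  have := probReal_compl_eq_one_sub (μ := P) (hW.measurable n 0 (measurableSet_gridCell hρ S))
  rw [← sub_eq_add_neg]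
  exact this.symm

end Convergence

/-! ### Bounds for the failure of separation -/

theorem measureReal_not_isSeparated_le {Ω ι : Type*} [MeasurableSpace Ω] {P : Measure Ω}
    [IsProbabilityMeasure P] {k L : ℕ} (c : Ω → ι → Fin k → Fin (L + 1)) :
    P.real {ω | ¬ IsSeparated (c ω)} ≤ ∑ j, P.real {ω | ∀ i, ¬ c ω i j ≠ 0} +
      ∑ j, ∑ l with l ≠ 0, P.real {ω | ∃ i i', i ≠ i' ∧ c ω i j = l ∧ c ω i' j = l} := by
  have hsub : {ω | ¬ IsSeparated (c ω)} ⊆ (⋃ j, {ω | ∀ i, ¬ c ω i j ≠ 0}) ∪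
      ⋃ j, ⋃ l ∈ Finset.univ.filter (fun l : Fin (L + 1) => l ≠ 0),
        {ω | ∃ i i', i ≠ i' ∧ c ω i j = l ∧ c ω i' j = l} := by
    intro ω hω
    rw [mem_ofPred_eq, IsSeparated, not_and_or] at hω
    push Not at hω
    rcases hω with ⟨j, hj⟩ | ⟨j, l, hl, h⟩
    · exact Or.inl (mem_iUnion.2 ⟨j, fun i => not_not.2 (hj i)⟩)
    · refine Or.inr (mem_iUnion.2 ⟨j, mem_iUnion₂.2 ⟨l, ?_, h⟩⟩)
      simpa using hl
  refine (measureReal_mono hsub (measure_ne_top _ _)).trans ((measureReal_union_le _ _).trans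
    (add_le_add (measureReal_iUnion_fintype_le _) ((measureReal_iUnion_fintype_le _).trans ?_)))
  exact Finset.sum_le_sum fun j _ => measureReal_biUnion_finset_le _ _

theorem measurableSet_mem_occupiedCells {Ω ι : Type*} [MeasurableSpace Ω] [Countable ι] {k L : ℕ}
    {ρ : ℝ} (hρ : 0 < ρ) {ψ : ι → Ω → Fin k → ℝ} (hψ : ∀ i, Measurable (ψ i))
    (x : Fin k → Fin (L + 1)) :
    MeasurableSet {ω | x ∈ occupiedCells fun i => gridCell L ρ (ψ i ω)} := by
  have : {ω | x ∈ occupiedCells fun i => gridCell L ρ (ψ i ω)} =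
      {_ω | x ≠ 0} ∩ ⋃ i, ψ i ⁻¹' {y | gridCell L ρ y ∈ ({x} : Set _)} := by
    ext ω
    simp [occupiedCells]
  rw [this]
  exact (MeasurableSet.const _).inter
    (MeasurableSet.iUnion fun i => hψ i (measurableSet_gridCell hρ _))

theorem forall_notMem_occupiedCells_iff {ι : Type*} {k L : ℕ} {c : ι → Fin k → Fin (L + 1)}
    {R : Finset (Fin k → Fin (L + 1))} :
    (∀ x ∈ R, x ∉ occupiedCells c) ↔ ∀ i, c i ∉ {x | x ∈ R ∧ x ≠ 0} := by
  constructor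
  · exact fun H i hi => H _ hi.1 ⟨hi.2, i, rfl⟩
  · rintro H _ hx ⟨h0, i, rfl⟩
    exact H i ⟨hx, h0⟩

theorem abs_measureReal_sub_le {Ω : Type*} [MeasurableSpace Ω] {P : Measure Ω}
    [IsProbabilityMeasure P] {A B N : Set Ω} (h : ∀ ω ∉ N, ω ∈ A ↔ ω ∈ B) :
    |P.real A - P.real B| ≤ P.real N := by
  have key : ∀ {A B : Set Ω}, (∀ ω ∉ N, ω ∈ A ↔ ω ∈ B) → P.real A ≤ P.real B + P.real N :=
    fun {A B} h => by
      refine (measureReal_mono (fun ω hω => ?_) (measure_ne_top _ _)).trans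
        (measureReal_union_le B N)
      by_cases hN : ω ∈ N
      · exact Or.inr hN
      · exact Or.inl ((h ω hN).1 hω)
  rw [abs_sub_le_iff]
  exact ⟨by linarith [key h], by linarith [key fun ω hω => (h ω hω).symm]⟩

section SeparatedLimit

variable {Ω : Type*} [MeasurableSpace Ω] {P : Measure Ω} [IsProbabilityMeasure P] {k : ℕ}
  {ζ : ℕ → Ω → ℝ} {V : ℕ → Ω → Fin k → ℝ} {L : ℕ} {ρ : ℝ}

theorem IsSpectralVector.measureReal_gridLevel_eq_zero (h : IsSpectralVector ζ V P) (hρ : 0 < ρ)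
    (j : Fin k) :
    P.real {ω | ∀ i, ¬ gridCell L ρ (ζ i ω • V i ω) j ≠ 0} = Real.exp (-(L / ρ)) := by
  have h1 := h.measureReal_forall_gridCell_notMem hρ (L := L) (S := {x | x j ≠ 0}) (by simp)
  simp only [mem_ofPred_eq] at h1
  rw [h1]
  have h2 := h.exponentMeasure_lt_gridLevel (L := L) hρ j 0
  simp only [Fin.pos_iff_ne_zero] at h2
  have h3 : (exponentMeasure (P.map (V 0))).real {y | gridCell L ρ y j ≠ 0} = L / ρ := by
    rw [measureReal_def]
    refine (congrArg ENNReal.toReal h2).trans ?_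
    rw [ENNReal.toReal_ofReal] <;> simp
    positivity
  rw [h3]

theorem IsSpectralVector.measureReal_exists_gridLevel_eq_le (h : IsSpectralVector ζ V P)
    (hρ : 0 < ρ) (j : Fin k) {l : Fin (L + 1)} (hl : l ≠ 0) :
    P.real {ω | ∃ i i', i ≠ i' ∧ gridCell L ρ (ζ i ω • V i ω) j = l ∧
      gridCell L ρ (ζ i' ω • V i' ω) j = l} ≤ (1 / ρ) ^ 2 := by
  rw [← h.exponentMeasure_gridLevel_eq hρ j hl]
  refine h.measure_exists_ne_le (measurableSet_gridLevel hρ j {l}) ?_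
  exact h.exponentMeasure_gridCell_mem hρ (S := {x | x j = l}) (fun h0 => hl h0.symm)

theorem IsSpectralVector.measureReal_not_isSeparated_le (h : IsSpectralVector ζ V P)
    (hρ : 0 < ρ) :
    P.real {ω | ¬ IsSeparated fun i => gridCell L ρ (ζ i ω • V i ω)} ≤
      ∑ _j : Fin k, Real.exp (-(L / ρ)) +
        ∑ _j : Fin k, ∑ l : Fin (L + 1) with l ≠ 0, (1 / ρ) ^ 2 := by
  refine (Concurrence.measureReal_not_isSeparated_le
    fun ω i => gridCell L ρ (ζ i ω • V i ω)).trans (add_le_add ?_ ?_)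
  · exact Finset.sum_le_sum fun j _ => (h.measureReal_gridLevel_eq_zero hρ j).le
  · exact Finset.sum_le_sum fun j _ => Finset.sum_le_sum fun l hl =>
      h.measureReal_exists_gridLevel_eq_le hρ j (Finset.mem_filter.1 hl).2

end SeparatedLimit

/-! ### Convergence of scenarios -/

section Convergence

variable {Ω Ω' : Type*} [MeasurableSpace Ω] [MeasurableSpace Ω']
  {P : Measure Ω} {P' : Measure Ω'} [IsProbabilityMeasure P] [IsProbabilityMeasure P'] {k : ℕ}
  {ζ : ℕ → Ω' → ℝ} {V : ℕ → Ω' → Fin k → ℝ} {W : ℕ → ℕ → Ω → Fin k → ℝ}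

/-- Each scenario is replaced by its cell version, at the cost of the probability that separation
fails. The factor 2 in `hε` counts this cost once for the limit of the row bounds and once for the
Poisson points; the cell versions themselves converge. -/
theorem eventually_abs_hittingScenario_sub_lt (hV : IsSpectralVector ζ V P')
    (hW : IsIIDArray W P) {L : ℕ} {ρ : ℝ} (hρ : 0 < ρ)
    (H : ∀ a, Tendsto (fun n => P.real {ω | ∀ i : Fin n, gridCell L ρ (W n i ω) ≤ a}) atTop
      (𝓝 (P'.real {ω | ∀ i, gridCell L ρ (ζ i ω • V i ω) ≤ a})))
    (τ : Partitions k) {ε : ℝ}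
    (hε : 2 * (∑ _j : Fin k, Real.exp (-(L / ρ)) +
      ∑ _j : Fin k, ∑ l : Fin (L + 1) with l ≠ 0, (1 / ρ) ^ 2) < ε) :
    ∀ᶠ n in atTop, |P.real {ω | hittingScenario (fun (i : Fin n) => W n i ω) = τ} -
      P'.real {ω | hittingScenario (fun i : ℕ => ζ i ω • V i ω) = τ}| < ε := by
  set B := ∑ _j : Fin k, Real.exp (-(L / ρ)) +
      ∑ _j : Fin k, ∑ l : Fin (L + 1) with l ≠ 0, (1 / ρ) ^ 2 with hB
  let b : ℕ → ℝ := fun n =>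
    ∑ j : Fin k, P.real {ω | ∀ i : Fin n, gridCell L ρ (W n i ω) ∉ {x | x j ≠ 0}} +
      ∑ j : Fin k, ∑ l : Fin (L + 1) with l ≠ 0,
        (n * P.real {ω | gridCell L ρ (W n 0 ω) ∈ {x | x j = l}}) ^ 2
  have hb : Tendsto b atTop (𝓝 B) := by
    refine Tendsto.add (tendsto_finsetSum _ fun j _ => ?_) (tendsto_finsetSum _ fun j _ =>
      tendsto_finsetSum _ fun l hl => ?_)
    · rw [← hV.measureReal_gridLevel_eq_zero hρ j]
      exact tendsto_measureReal_forall_gridCell_notMem hV hW hρ H (L := L) (S := {x | x j ≠ 0}) (by simp)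
    · have hl0 := (Finset.mem_filter.1 hl).2
      rw [← hV.exponentMeasure_gridLevel_eq hρ j hl0]
      exact (tendsto_mul_measureReal_gridCell_mem hV hW hρ H (S := {x | x j = l})
        (fun h0 => hl0 h0.symm)).pow 2
  have hsep : ∀ n, P.real {ω | ¬ IsSeparated fun i : Fin n => gridCell L ρ (W n i ω)} ≤ b n :=
    fun n => (measureReal_not_isSeparated_le
      fun ω (i : Fin n) => gridCell L ρ (W n i ω)).trans (add_le_add le_rfl
        (Finset.sum_le_sum fun j _ => Finset.sum_le_sum fun l _ =>
          hW.measureReal_exists_ne_le (measurableSet_gridLevel hρ j {l}) n))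
  let A : ℕ → ℝ := fun n => P.real {ω | cellScenario
    (occupiedCells fun i : Fin n => gridCell L ρ (W n i ω)) = τ}
  set A' : ℝ := P'.real {ω | cellScenario
    (occupiedCells fun i : ℕ => gridCell L ρ (ζ i ω • V i ω)) = τ} with hA'
  have hA : Tendsto A atTop (𝓝 A') := by
    refine tendsto_measureReal_comp
      (O := fun n ω => occupiedCells fun i : Fin n => gridCell L ρ (W n i ω))
      (O' := fun ω => occupiedCells fun i : ℕ => gridCell L ρ (ζ i ω • V i ω))
      (fun n => measurableSet_mem_occupiedCells hρ fun i : Fin n => hW.measurable n i)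
      (measurableSet_mem_occupiedCells hρ fun i => hV.measurable_point i)
      (fun R => ?_) cellScenario τ
    simp only [forall_notMem_occupiedCells_iff]
    exact tendsto_measureReal_forall_gridCell_notMem hV hW hρ H (by simp)
  have hlim : Tendsto (fun n => b n + |A n - A'| + B) atTop (𝓝 (B + |A' - A'| + B)) :=
    (hb.add (hA.sub_const A').abs).add_const B
  rw [sub_self, abs_zero, add_zero, ← two_mul] at hlim
  filter_upwards [hlim.eventually (gt_mem_nhds hε)] with n hn
  refine lt_of_le_of_lt ?_ hn
  have h1 := abs_measureReal_sub_le (P := P)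
    (A := {ω | hittingScenario (fun (i : Fin n) => W n i ω) = τ})
    (B := {ω | cellScenario (occupiedCells fun i : Fin n => gridCell L ρ (W n i ω)) = τ})
    (N := {ω | ¬ IsSeparated fun i : Fin n => gridCell L ρ (W n i ω)}) (fun ω hω => by
      rw [mem_ofPred_eq, mem_ofPred_eq, (not_not.1 hω : IsSeparated _).hittingScenario_eq hρ])
  have h2 := abs_measureReal_sub_le (P := P')
    (A := {ω | hittingScenario (fun (i : ℕ) => ζ i ω • V i ω) = τ})
    (B := {ω | cellScenario (occupiedCells fun i : ℕ => gridCell L ρ (ζ i ω • V i ω)) = τ})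
    (N := {ω | ¬ IsSeparated fun i : ℕ => gridCell L ρ (ζ i ω • V i ω)}) (fun ω hω => by
      rw [mem_ofPred_eq, mem_ofPred_eq, (not_not.1 hω : IsSeparated _).hittingScenario_eq hρ])
  have h3 := h1.trans (hsep n)
  have h4 := h2.trans (hV.measureReal_not_isSeparated_le hρ)
  have h5 := abs_le.1 h3
  have h6 := abs_le.1 h4
  have h7 := abs_le.1 (le_refl |A n - A'|)
  rw [abs_le]
  constructor <;> simp only [A] at * <;> linarith

/-- The hitting scenarios of a triangular array converge if the componentwise maxima do. -/
theorem tendsto_measureReal_hittingScenario (hV : IsSpectralVector ζ V P')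
    (hW : IsIIDArray W P)
    (H : ∀ (L : ℕ) (ρ : ℝ), 0 < ρ → ∀ a,
      Tendsto (fun n => P.real {ω | ∀ i : Fin n, gridCell L ρ (W n i ω) ≤ a}) atTop
      (𝓝 (P'.real {ω | ∀ i, gridCell L ρ (ζ i ω • V i ω) ≤ a})))
    (τ : Partitions k) :
    Tendsto (fun n => P.real {ω | hittingScenario (fun (i : Fin n) => W n i ω) = τ}) atTop
      (𝓝 (P'.real {ω | hittingScenario (fun i : ℕ => ζ i ω • V i ω) = τ})) := by
  rw [Metric.tendsto_nhds]
  intro ε hε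
  have hB : Tendsto (fun m : ℕ => 2 * (k * Real.exp (-(m : ℝ)) + k * (m : ℝ)⁻¹)) atTop (𝓝 0) := by
    have h1 : Tendsto (fun m : ℕ => Real.exp (-(m : ℝ))) atTop (𝓝 0) :=
      Real.tendsto_exp_neg_atTop_nhds_zero.comp tendsto_natCast_atTop_atTop
    have h2 := ((h1.const_mul (k : ℝ)).add
      (tendsto_inv_atTop_nhds_zero_nat (𝕜 := ℝ) |>.const_mul (k : ℝ))).const_mul 2
    simpa using h2
  -- With `ρ = m ^ 2` and `L = m ^ 3` one has `L / ρ = m` and `L / ρ ^ 2 = 1 / m`: the grid reaches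
  -- down to `1 / m` while the total probability of a shared level vanishes.
  obtain ⟨m, hm, hm1⟩ := ((hB.eventually (gt_mem_nhds hε)).and (eventually_ge_atTop 1)).exists
  have hm0 : (0 : ℝ) < m := by exact_mod_cast hm1
  have hρ : (0 : ℝ) < (m : ℝ) ^ 2 := by positivity
  have hk : 2 * (∑ _j : Fin k, Real.exp (-(((m ^ 3 : ℕ) : ℝ) / (m : ℝ) ^ 2)) +
      ∑ _j : Fin k, ∑ l : Fin (m ^ 3 + 1) with l ≠ 0, (1 / (m : ℝ) ^ 2) ^ 2) < ε := by
    refine lt_of_eq_of_lt ?_ hm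
    have hcard : (Finset.univ.filter fun l : Fin (m ^ 3 + 1) => l ≠ 0).card = m ^ 3 := by
      rw [Finset.filter_ne', Finset.card_erase_of_mem (Finset.mem_univ _), Finset.card_univ,
        Fintype.card_fin, Nat.add_sub_cancel]
    simp only [Finset.sum_const, Finset.card_univ, Fintype.card_fin, nsmul_eq_mul, hcard]
    have e1 : ((m ^ 3 : ℕ) : ℝ) / (m : ℝ) ^ 2 = m := by
      push_cast
      field_simp
    have e2 : ((m ^ 3 : ℕ) : ℝ) * (1 / (m : ℝ) ^ 2) ^ 2 = (m : ℝ)⁻¹ := by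
      push_cast
      field_simp
    rw [e1, e2]
  filter_upwards [eventually_abs_hittingScenario_sub_lt hV hW hρ (H _ _ hρ) τ hk] with n hn
  rwa [Real.dist_eq]

end Convergence

/-! ### Uniqueness of the maxima of the limit -/

section SpectralMaxima

variable {Ω : Type*} [MeasurableSpace Ω] {P : Measure Ω} [IsProbabilityMeasure P] {k : ℕ}
  {ζ : ℕ → Ω → ℝ} {V : ℕ → Ω → Fin k → ℝ}

theorem measurableSet_coord_lt {k : ℕ} (j : Fin k) (x : ℝ) :
    MeasurableSet {y : Fin k → ℝ | x < y j} :=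
  measurableSet_lt measurable_const (measurable_pi_apply j)

/-- The threshold `1 / (m + 1)` is exceeded with intensity `m + 1`, so no point exceeds it with
probability `exp (-(m + 1))`. -/
theorem IsSpectralVector.ae_exists_pos (h : IsSpectralVector ζ V P) (j : Fin k) :
    ∀ᵐ ω ∂P, ∃ i, 0 < (ζ i ω • V i ω) j := by
  rw [ae_iff]
  simp only [not_exists]
  have hle : ∀ m : ℕ, P {ω | ∀ i, ¬ 0 < (ζ i ω • V i ω) j} ≤
      ENNReal.ofReal (Real.exp (-((m : ℝ) + 1))) := fun m => by
    have hpos : (0 : ℝ) < 1 / ((m : ℝ) + 1) := by positivity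
    have h1 := h.exponentMeasure_lt j hpos
    have h2 := h.measure_forall_notMem (measurableSet_coord_lt j (1 / ((m : ℝ) + 1)))
      (by rw [h1]; exact ENNReal.ofReal_ne_top)
    rw [h1, one_div_one_div, ENNReal.toReal_ofReal (by positivity)] at h2
    rw [← h2]
    exact measure_mono fun ω hω i hi => hω i (hpos.trans hi)
  have hlim : Tendsto (fun m : ℕ => ENNReal.ofReal (Real.exp (-((m : ℝ) + 1)))) atTop (𝓝 0) := by
    rw [← ENNReal.ofReal_zero]
    exact ENNReal.tendsto_ofReal (Real.tendsto_exp_neg_atTop_nhds_zero.comp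
      (tendsto_atTop_add_const_right _ _ tendsto_natCast_atTop_atTop))
  exact le_antisymm (ge_of_tendsto' hlim hle) zero_le

theorem IsSpectralVector.ae_finite_lt (h : IsSpectralVector ζ V P) (j : Fin k) {x : ℝ}
    (hx : 0 < x) : ∀ᵐ ω ∂P, {i | x < (ζ i ω • V i ω) j}.Finite := by
  -- Borel–Cantelli: the probabilities sum to the finite intensity `1 / x`.
  refine ae_finite_setOfPred_mem (s := fun i => {ω | x < (ζ i ω • V i ω) j}) ?_
  have := h.tsum_measure_mem (measurableSet_coord_lt j x)
  rw [h.exponentMeasure_lt j hx] at this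
  exact this.trans_ne ENNReal.ofReal_ne_top

/-- Equal coordinates lie in a common level, which is positive once `1 / m ≤ x`. The `m ^ 3` levels
contribute at most `m ^ (-4)` each. -/
theorem IsSpectralVector.ae_forall_ne_of_lt (h : IsSpectralVector ζ V P) (j : Fin k) {x : ℝ}
    (hx : 0 < x) : ∀ᵐ ω ∂P, ∀ i i', i ≠ i' → x < (ζ i ω • V i ω) j →
      (ζ i ω • V i ω) j ≠ (ζ i' ω • V i' ω) j := by
  rw [ae_iff]
  push Not
  set N := {ω | ∃ i i', i ≠ i' ∧ x < (ζ i ω • V i ω) j ∧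
      (ζ i ω • V i ω) j = (ζ i' ω • V i' ω) j} with hN
  have hle : ∀ᶠ m : ℕ in atTop, P.real N ≤ (m : ℝ)⁻¹ := by
    filter_upwards [eventually_ge_atTop 1,
      tendsto_natCast_atTop_atTop.eventually_ge_atTop (1 / x)] with m hm1 hmx
    have hm0 : (0 : ℝ) < m := by exact_mod_cast hm1
    have hρ : (0 : ℝ) < (m : ℝ) ^ 2 := by positivity
    have hsub : N ⊆ ⋃ l ∈ Finset.univ.filter (fun l : Fin (m ^ 3 + 1) => l ≠ 0),
        {ω | ∃ i i', i ≠ i' ∧ gridCell (m ^ 3) ((m : ℝ) ^ 2) (ζ i ω • V i ω) j = l ∧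
          gridCell (m ^ 3) ((m : ℝ) ^ 2) (ζ i' ω • V i' ω) j = l} := by
      rintro ω ⟨i, i', hne, hi, heq⟩
      refine mem_iUnion₂.2 ⟨gridLevel (m ^ 3) ((m : ℝ) ^ 2) ((ζ i ω • V i ω) j), ?_,
        i, i', hne, rfl, ?_⟩
      · have h0 : ((0 : Fin (m ^ 3 + 1)) : ℕ) < m ^ 3 := by
          rw [Fin.val_zero]
          exact Nat.pow_pos hm1
        have hgt : ¬ gridLevel (m ^ 3) ((m : ℝ) ^ 2) ((ζ i ω • V i ω) j) ≤ 0 := by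
          rw [gridLevel_le_iff hρ h0, not_le]
          refine lt_of_le_of_lt ?_ hi
          have e1 : (m : ℝ) ^ 2 / (((m ^ 3 : ℕ) : ℝ) - ((0 : Fin (m ^ 3 + 1)) : ℕ)) = 1 / m := by
            push_cast
            simp
            field_simp
          rw [e1]
          exact (one_div_le hm0 hx).2 hmx
        simpa using fun h0 => hgt h0.le
      · simp only [gridCell, heq]
    refine (measureReal_mono hsub (measure_ne_top _ _)).trans
      ((measureReal_biUnion_finset_le _ _).trans ((Finset.sum_le_sum fun l hl =>
        h.measureReal_exists_gridLevel_eq_le hρ j (Finset.mem_filter.1 hl).2).trans_eq ?_))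
    have hcard : (Finset.univ.filter fun l : Fin (m ^ 3 + 1) => l ≠ 0).card = m ^ 3 := by
      rw [Finset.filter_ne', Finset.card_erase_of_mem (Finset.mem_univ _), Finset.card_univ,
        Fintype.card_fin, Nat.add_sub_cancel]
    simp only [Finset.sum_const, nsmul_eq_mul, hcard]
    push_cast
    field_simp
  have h0 : P.real N ≤ 0 := ge_of_tendsto (tendsto_inv_atTop_nhds_zero_nat (𝕜 := ℝ)) hle
  exact (measureReal_eq_zero_iff (measure_ne_top _ _)).1 (le_antisymm h0 measureReal_nonneg)

/-- Almost surely, each coordinate has exactly one maximal point. -/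
theorem IsSpectralVector.ae_exists_strict_max (h : IsSpectralVector ζ V P) :
    ∀ᵐ ω ∂P, ∀ j, ∃ i, ∀ i', i' ≠ i → (ζ i' ω • V i' ω) j < (ζ i ω • V i ω) j := by
  rw [ae_all_iff]
  intro j
  have hpos : ∀ m : ℕ, (0 : ℝ) < 1 / ((m : ℝ) + 1) := fun m => by positivity
  filter_upwards [h.ae_exists_pos j, ae_all_iff.2 fun m : ℕ => h.ae_finite_lt j (hpos m),
    ae_all_iff.2 fun m : ℕ => h.ae_forall_ne_of_lt j (hpos m)] with ω h1 h2 h3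
  obtain ⟨i₀, hi₀⟩ := h1
  obtain ⟨m, hm⟩ := exists_nat_one_div_lt hi₀
  obtain ⟨i, hi, hmax⟩ := Set.exists_max_image _ (fun i => (ζ i ω • V i ω) j) (h2 m) ⟨i₀, hm⟩
  refine ⟨i, fun i' hne => lt_of_le_of_ne ?_ (h3 m i i' hne.symm hi).symm⟩
  by_cases hi' : 1 / ((m : ℝ) + 1) < (ζ i' ω • V i' ω) j
  · exact hmax i' hi'
  · exact (not_lt.1 hi').trans (le_of_lt hi)

theorem IsSpectralVector.ae_forall_ne (h : IsSpectralVector ζ V P) (j : Fin k) {x : ℝ}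
    (hx : 0 < x) : ∀ᵐ ω ∂P, ∀ i, (ζ i ω • V i ω) j ≠ x := by
  have hR : MeasurableSet {y : Fin k → ℝ | y j = x} :=
    measurableSet_eq_fun (measurable_pi_apply j) measurable_const
  have h0 : exponentMeasure (P.map (V 0)) {y | y j = x} = 0 := by
    have hle : ∀ m : ℕ, exponentMeasure (P.map (V 0)) {y | y j = x} ≤
        ENNReal.ofReal (1 / ((m : ℝ) + 1)) := fun m => by
      have hρ : (0 : ℝ) < (m : ℝ) + 1 := by positivity
      -- This `L` puts the lowest grid point `ρ / L` below `x`, so the level of `x` is positive and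
      -- has mass `1 / (m + 1)`.
      obtain ⟨L, hL⟩ := exists_nat_gt (((m : ℝ) + 1) / x)
      have hL0 : (0 : ℝ) < L := lt_trans (by positivity) hL
      have hl : gridLevel L ((m : ℝ) + 1) x ≠ 0 := fun hl => by
        have := (gridLevel_le_iff (a := 0) hρ (by exact_mod_cast hL0) x).1 hl.le
        rw [Fin.val_zero, Nat.cast_zero, sub_zero] at this
        rw [div_lt_iff₀ hx] at hL
        rw [le_div_iff₀ hL0] at this
        linarith
      have h1 := h.exponentMeasure_gridLevel_eq hρ j hl
      have hfin : exponentMeasure (P.map (V 0))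
          {y | gridLevel L ((m : ℝ) + 1) (y j) = gridLevel L ((m : ℝ) + 1) x} ≠ ∞ :=
        h.exponentMeasure_gridCell_mem hρ (S := {c | c j = gridLevel L ((m : ℝ) + 1) x}) (fun h0 => hl h0.symm)
      rw [← h1, measureReal_def, ENNReal.ofReal_toReal hfin]
      exact measure_mono fun y hy => congrArg _ hy
    have hlim : Tendsto (fun m : ℕ => ENNReal.ofReal (1 / ((m : ℝ) + 1))) atTop (𝓝 0) := by
      rw [← ENNReal.ofReal_zero]
      exact ENNReal.tendsto_ofReal tendsto_one_div_add_atTop_nhds_zero_nat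
    exact le_antisymm (ge_of_tendsto' hlim hle) zero_le
  rw [ae_all_iff]
  intro i
  have h1 := h.tsum_measure_mem hR
  rw [h0, ENNReal.tsum_eq_zero] at h1
  exact measure_eq_zero_iff_ae_notMem.1 (h1 i)

end SpectralMaxima

/-! ### Convergence of maxima on orthants -/

theorem bddAbove_range_of_strict_max {ι : Type*} {u : ι → ℝ} {i : ι}
    (h : ∀ i', i' ≠ i → u i' < u i) : BddAbove (range u) :=
  ⟨u i, by
    rintro _ ⟨i', rfl⟩
    rcases eq_or_ne i' i with rfl | hne
    · exact le_rfl
    · exact (h i' hne).le⟩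

theorem ciSup_eq_iff_mem_argMax {ι : Type*} {u : ι → ℝ} (hu : BddAbove (range u)) (i : ι) :
    ⨆ i', u i' = u i ↔ i ∈ argMax u :=
  have : Nonempty ι := ⟨i⟩
  ⟨fun h i' => h ▸ le_ciSup hu i', fun h => le_antisymm (ciSup_le h) (le_ciSup hu i)⟩

/-- The vectors all of whose coordinates have levels at most `a`. -/
def lowerOrthant {k L : ℕ} (ρ : ℝ) (a : Fin k → Fin (L + 1)) : Set (Fin k → ℝ) :=
  {y | ∀ j, (a j : ℕ) < L → y j ≤ ρ / ((L : ℝ) - a j)}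

theorem gridCell_le_iff {k L : ℕ} {ρ : ℝ} (hρ : 0 < ρ) {a : Fin k → Fin (L + 1)}
    {y : Fin k → ℝ} : gridCell L ρ y ≤ a ↔ y ∈ lowerOrthant ρ a := by
  refine forall_congr' fun j => ?_
  by_cases ha : (a j : ℕ) < L
  · exact (gridLevel_le_iff hρ ha (y j)).trans ⟨fun h _ => h, fun h => h ha⟩
  · refine ⟨fun _ h => absurd h ha, fun _ => ?_⟩
    have h1 := (gridLevel L ρ (y j)).is_lt
    exact Fin.le_def.2 (by omega : (gridLevel L ρ (y j) : ℕ) ≤ a j)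

theorem frontier_lowerOrthant_subset {k L : ℕ} {ρ : ℝ} (a : Fin k → Fin (L + 1)) :
    frontier (lowerOrthant ρ a) ⊆ {y | ∃ j, (a j : ℕ) < L ∧ y j = ρ / ((L : ℝ) - a j)} := by
  have hclosed : IsClosed (lowerOrthant ρ a) := by
    have : lowerOrthant ρ a = ⋂ j, ⋂ _ : (a j : ℕ) < L, {y | y j ≤ ρ / ((L : ℝ) - a j)} := by
      ext y
      simp [lowerOrthant]
    rw [this]
    exact isClosed_iInter fun j => isClosed_iInter fun _ =>
      isClosed_le (continuous_apply j) continuous_const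
  intro y hy
  rw [hclosed.frontier_eq] at hy
  by_contra hne
  rw [mem_ofPred_eq] at hne
  push Not at hne
  have hopen : IsOpen {y : Fin k → ℝ | ∀ j, (a j : ℕ) < L → y j < ρ / ((L : ℝ) - a j)} := by
    have : {y : Fin k → ℝ | ∀ j, (a j : ℕ) < L → y j < ρ / ((L : ℝ) - a j)} =
        ⋂ j, ⋂ _ : (a j : ℕ) < L, {y | y j < ρ / ((L : ℝ) - a j)} := by
      ext y
      simp
    rw [this]
    exact isOpen_iInter_of_finite fun j => isOpen_iInter_of_finite fun _ =>
      isOpen_lt (continuous_apply j) continuous_const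
  exact hy.2 (interior_maximal (fun z hz j hj => (hz j hj).le) hopen
    fun j hj => lt_of_le_of_ne (hy.1 j hj) (hne j hj))

theorem measurableSet_lowerOrthant {k L : ℕ} {ρ : ℝ} (a : Fin k → Fin (L + 1)) :
    MeasurableSet (lowerOrthant ρ a) := by
  have : lowerOrthant ρ a = ⋂ j, ⋂ _ : (a j : ℕ) < L, {y | y j ≤ ρ / ((L : ℝ) - a j)} := by
    ext y
    simp [lowerOrthant]
  rw [this]
  exact MeasurableSet.iInter fun j => MeasurableSet.iInter fun _ =>
    measurableSet_le (measurable_pi_apply j) measurable_const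

section Maxima

variable {Ω Ω' : Type*} [MeasurableSpace Ω] [MeasurableSpace Ω']
  {P : Measure Ω} {P' : Measure Ω'} [IsProbabilityMeasure P] [IsProbabilityMeasure P'] {k : ℕ}
  {ζ : ℕ → Ω' → ℝ} {V : ℕ → Ω' → Fin k → ℝ} {W : ℕ → ℕ → Ω → Fin k → ℝ}

/-- Portmanteau on a lower orthant: its boundary is null for the limit, since the maxima are
attained and almost surely no point has a coordinate equal to a given positive threshold. -/
theorem tendsto_measureReal_forall_gridCell_le (hV : IsSpectralVector ζ V P')
    {M : ℕ → Ω → Fin k → ℝ}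
    (hM : TendstoInDistribution M atTop (fun ω j => ⨆ i, (ζ i ω • V i ω) j) (fun _ => P) P')
    (hMW : ∀ n, 1 ≤ n → ∀ᵐ ω ∂P, ∀ j x, M n ω j ≤ x ↔ ∀ i : Fin n, W n i ω j ≤ x)
    {L : ℕ} {ρ : ℝ} (hρ : 0 < ρ) (a : Fin k → Fin (L + 1)) :
    Tendsto (fun n => P.real {ω | ∀ i : Fin n, gridCell L ρ (W n i ω) ≤ a}) atTop
      (𝓝 (P'.real {ω | ∀ i, gridCell L ρ (ζ i ω • V i ω) ≤ a})) := by
  have hA := measurableSet_lowerOrthant (ρ := ρ) a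
  have hpos : ∀ j, (a j : ℕ) < L → 0 < ρ / ((L : ℝ) - a j) := fun j hj =>
    div_pos hρ (sub_pos.2 (by exact_mod_cast hj))
  have hfr : P'.map (fun ω j => ⨆ i, (ζ i ω • V i ω) j) (frontier (lowerOrthant ρ a)) = 0 := by
    rw [Measure.map_apply_of_aemeasurable hM.aemeasurable_limit isClosed_frontier.measurableSet]
    refine measure_eq_zero_iff_ae_notMem.2 ?_
    have hne : ∀ᵐ ω ∂P', ∀ j, (a j : ℕ) < L → ∀ i, (ζ i ω • V i ω) j ≠ ρ / ((L : ℝ) - a j) :=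
      ae_all_iff.2 fun j => by
        by_cases hj : (a j : ℕ) < L
        · filter_upwards [hV.ae_forall_ne j (hpos j hj)] with ω hω _
          exact hω
        · exact ae_of_all _ fun ω h => absurd h hj
    filter_upwards [hne, hV.ae_exists_strict_max] with ω h1 h2 hω
    obtain ⟨j, hj, hjeq⟩ := frontier_lowerOrthant_subset a hω
    obtain ⟨i, hi⟩ := h2 j
    have h3 : i ∈ argMax fun i => (ζ i ω • V i ω) j := by
      rw [argMax_eq_singleton hi]
      rfl
    change ⨆ i, (ζ i ω • V i ω) j = _ at hjeq
    rw [(ciSup_eq_iff_mem_argMax (bddAbove_range_of_strict_max hi) i).2 h3] at hjeq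
    exact h1 j hj i hjeq
  have hconv := ProbabilityMeasure.tendsto_measure_of_null_frontier_of_tendsto' hM.tendsto hfr
  have := Measure.isProbabilityMeasure_map hM.aemeasurable_limit
  have hconv' := (ENNReal.tendsto_toReal (measure_ne_top (P'.map _) _)).comp hconv
  have hlim : (P'.map (fun ω j => ⨆ i, (ζ i ω • V i ω) j) (lowerOrthant ρ a)).toReal =
      P'.real {ω | ∀ i, gridCell L ρ (ζ i ω • V i ω) ≤ a} := by
    rw [Measure.map_apply_of_aemeasurable hM.aemeasurable_limit hA, measureReal_def]
    congr 1
    refine measure_congr ?_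
    filter_upwards [hV.ae_exists_strict_max] with ω hω
    refine propext ?_
    change (fun j => ⨆ i, (ζ i ω • V i ω) j) ∈ lowerOrthant ρ a ↔
      ∀ i, gridCell L ρ (ζ i ω • V i ω) ≤ a
    simp only [gridCell_le_iff hρ]
    constructor
    · intro H i j hj
      obtain ⟨i', hi'⟩ := hω j
      exact (le_ciSup (bddAbove_range_of_strict_max hi') i).trans (H j hj)
    · exact fun H j hj => ciSup_le fun i => H i j hj
  rw [← hlim]
  refine hconv'.congr' ?_
  -- For `n = 0` the supremum over `Fin 0` is the default value 0.
  filter_upwards [eventually_ge_atTop 1] with n hn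
  change (P.map (M n) (lowerOrthant ρ a)).toReal = _
  rw [Measure.map_apply_of_aemeasurable (hM.forall_aemeasurable n) hA, measureReal_def]
  congr 1
  refine measure_congr ?_
  filter_upwards [hMW n hn] with ω hω
  refine propext ?_
  change M n ω ∈ lowerOrthant ρ a ↔ ∀ i : Fin n, gridCell L ρ (W n i ω) ≤ a
  simp only [gridCell_le_iff hρ]
  constructor
  · exact fun H i j hj => (hω j _).1 (H j hj) i
  · exact fun H j hj => (hω j _).2 fun i => H i j hj

end Maxima

/-! ### Scenarios: measurability, blocks and concurrence -/

theorem part_hittingScenario_eq_iff {ι : Type*} {k : ℕ} (ψ : ι → Fin k → ℝ) (τ : Partitions k) :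
    hittingScenario ψ = τ ↔ ∀ j₁ j₂,
      (argMax fun i => ψ i j₁) = (argMax fun i => ψ i j₂) ↔ j₂ ∈ τ.part j₁ := by
  constructor
  · rintro rfl j₁ j₂
    exact (mem_same_block_iff ψ j₁ j₂).symm
  · intro h
    have hpart : ∀ j, (hittingScenario ψ).part j = τ.part j := fun j => by
      ext j'
      rw [mem_same_block_iff, h]
    have hsub : ∀ σ σ' : Partitions k, (∀ j, σ.part j = σ'.part j) → σ.parts ⊆ σ'.parts :=
      fun σ σ' H C hC => by
        obtain ⟨j, hj⟩ := σ.nonempty_of_mem_parts hC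
        rw [← σ.part_eq_of_mem hC hj, H]
        exact σ'.part_mem.2 (Finset.mem_univ j)
    exact Finpartition.ext (Finset.Subset.antisymm (hsub _ _ hpart) (hsub _ _ fun j => (hpart j).symm))

theorem measurable_hittingScenario {Ω ι : Type*} [MeasurableSpace Ω] [Countable ι] {k : ℕ}
    {ψ : ι → Ω → Fin k → ℝ} (hψ : ∀ i j, Measurable fun ω => ψ i ω j) :
    Measurable fun ω => hittingScenario fun i => ψ i ω := by
  refine measurable_to_countable' fun τ => ?_
  have hmem : ∀ i j, MeasurableSet {ω | i ∈ argMax fun i' => ψ i' ω j} := fun i j => by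
    have : {ω | i ∈ argMax fun i' => ψ i' ω j} = ⋂ i', {ω | ψ i' ω j ≤ ψ i ω j} := by
      ext ω
      simp [argMax]
    rw [this]
    exact MeasurableSet.iInter fun i' => measurableSet_le (hψ i' j) (hψ i j)
  have : (fun ω => hittingScenario fun i => ψ i ω) ⁻¹' {τ} = ⋂ j₁, ⋂ j₂,
      {ω | (∀ i, i ∈ (argMax fun i' => ψ i' ω j₁) ↔ i ∈ argMax fun i' => ψ i' ω j₂) ↔
        j₂ ∈ τ.part j₁} := by
    ext ω
    simp [part_hittingScenario_eq_iff, Set.ext_iff]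
  rw [this]
  refine MeasurableSet.iInter fun j₁ => MeasurableSet.iInter fun j₂ =>
    MeasurableSet.iff ?_ (MeasurableSet.const _)
  have : {ω | ∀ i, i ∈ (argMax fun i' => ψ i' ω j₁) ↔ i ∈ argMax fun i' => ψ i' ω j₂} =
      ⋂ i, {ω | i ∈ (argMax fun i' => ψ i' ω j₁) ↔ i ∈ argMax fun i' => ψ i' ω j₂} := by
    ext ω
    simp
  change MeasurableSet {ω | ∀ i, i ∈ (argMax fun i' => ψ i' ω j₁) ↔ i ∈ argMax fun i' => ψ i' ω j₂}
  rw [this]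
  exact MeasurableSet.iInter fun i => (hmem i j₁).iff (hmem i j₂)

/-- With unique maximizers `m j`, the block of `j` is the set of coordinates at which `m j` is
maximal. -/
theorem mem_parts_hittingScenario_iff {ι : Type*} {k : ℕ} {ψ : ι → Fin k → ℝ}
    (h : ∀ j, ∃ i, (argMax fun i => ψ i j) = {i}) (C : Finset (Fin k)) :
    C ∈ (hittingScenario ψ).parts ↔
      C.Nonempty ∧ ∃ i, (C : Set (Fin k)) = {j | i ∈ argMax fun i' => ψ i' j} := by
  choose m hm using h
  have hpart : ∀ j, ((hittingScenario ψ).part j : Set (Fin k)) =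
      {j' | m j ∈ argMax fun i' => ψ i' j'} := fun j => by
    ext j'
    rw [Finset.mem_coe, mem_same_block_iff, hm, hm, mem_ofPred_eq, hm, singleton_eq_singleton_iff,
      mem_singleton_iff]
  constructor
  · intro hC
    obtain ⟨j, hj⟩ := (hittingScenario ψ).nonempty_of_mem_parts hC
    refine ⟨⟨j, hj⟩, m j, ?_⟩
    rw [← hpart, (hittingScenario ψ).part_eq_of_mem hC hj]
  · rintro ⟨⟨j, hj⟩, i, hi⟩
    have hij : i = m j := by
      have hj' : j ∈ (C : Set (Fin k)) := hj
      rw [hi, mem_ofPred_eq, hm, mem_singleton_iff] at hj'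
      exact hj'
    have : C = (hittingScenario ψ).part j := by
      rw [← Finset.coe_inj, hpart, hi, hij]
    rw [this]
    exact (hittingScenario ψ).part_mem.2 (Finset.mem_univ j)

theorem exists_mem_argMax_iff {ι : Type*} [Nonempty ι] {k : ℕ} {ψ : ι → Fin k → ℝ}
    (h : ∀ j, ∃ i, (argMax fun i => ψ i j) = {i}) :
    (∃ l, ∀ j, l ∈ argMax fun i => ψ i j) ↔
      ∀ j₁ j₂, j₂ ∈ (hittingScenario ψ).part j₁ := by
  choose m hm using h
  simp only [mem_same_block_iff, hm, mem_singleton_iff, singleton_eq_singleton_iff]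
  constructor
  · rintro ⟨l, hl⟩ j₁ j₂
    rw [← hl, ← hl]
  · intro H
    -- Without sites any index will do, which is where `Nonempty ι` enters.
    rcases isEmpty_or_nonempty (Fin k) with hk | ⟨⟨j⟩⟩
    · exact ⟨Classical.arbitrary ι, fun j => hk.elim j⟩
    · exact ⟨m j, fun j' => H j j'⟩

/-! ### Observations: absence of ties and marginal transformations -/

theorem argMax_congr {ι : Type*} {u w : ι → ℝ} (h : ∀ i i', u i ≤ u i' ↔ w i ≤ w i') :
    argMax u = argMax w := by
  ext i
  exact forall_congr' fun i' => h i' i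

theorem exists_argMax_eq_singleton {ι : Type*} [Finite ι] [Nonempty ι] {u : ι → ℝ}
    (h : Function.Injective u) : ∃ i, argMax u = {i} := by
  obtain ⟨i, hi⟩ := Finite.exists_max u
  exact ⟨i, argMax_eq_singleton fun i' hne => lt_of_le_of_ne (hi i') fun heq => hne (h heq)⟩

theorem noAtoms_of_continuous_cdf (μ : Measure ℝ) [IsProbabilityMeasure μ]
    (h : Continuous (cdf μ)) : NullSingletonClass μ where
  measure_singleton x := by
    rw [← measure_cdf μ, StieltjesFunction.measure_singleton,
      h.continuousAt.continuousWithinAt.leftLim_eq, sub_self, ENNReal.ofReal_zero]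

theorem ae_ne_of_indepFun {Ω : Type*} [MeasurableSpace Ω] {P : Measure Ω} [IsProbabilityMeasure P]
    {U U' : Ω → ℝ} (hU : Measurable U) (hU' : Measurable U') (h : IndepFun U U' P)
    (hno : NullSingletonClass (P.map U')) : ∀ᵐ ω ∂P, U ω ≠ U' ω := by
  have hd : MeasurableSet {p : ℝ × ℝ | p.1 = p.2} := measurableSet_eq_fun measurable_fst measurable_snd
  have := Measure.isProbabilityMeasure_map (μ := P) hU.aemeasurable
  have := Measure.isProbabilityMeasure_map (μ := P) hU'.aemeasurable
  suffices h0 : P {ω | U ω = U' ω} = 0 from measure_eq_zero_iff_ae_notMem.1 h0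
  have h1 : P {ω | U ω = U' ω} = P.map (fun ω => (U ω, U' ω)) {p : ℝ × ℝ | p.1 = p.2} := by
    rw [Measure.map_apply (hU.prodMk hU') hd]
    rfl
  rw [h1, (indepFun_iff_map_prod_eq_prod_map_map hU.aemeasurable hU'.aemeasurable).1 h,
    Measure.measure_prod_null hd]
  refine ae_of_all _ fun x => ?_
  have : Prod.mk x ⁻¹' {p : ℝ × ℝ | p.1 = p.2} = {x} := by
    ext y
    simp [eq_comm]
  change P.map U' (Prod.mk x ⁻¹' {p : ℝ × ℝ | p.1 = p.2}) = 0
  rw [this, measure_singleton]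

theorem IndepCopies.ae_injective {Ω T : Type*} [MeasurableSpace Ω] {P : Measure Ω}
    [IsProbabilityMeasure P] {X : ℕ → Ω → T → ℝ} (hX : IndepCopies X P) (t : T)
    (hcont : Continuous (cdf (P.map fun ω => X 0 ω t))) :
    ∀ᵐ ω ∂P, Function.Injective fun i => X i ω t := by
  have hid : ∀ i, P.map (fun ω => X i ω t) = P.map fun ω => X 0 ω t := fun i =>
    ((hX.identDistrib i).comp (u := fun y : T → ℝ => y t) (measurable_pi_apply t)).map_eq
  have := Measure.isProbabilityMeasure_map (μ := P) (hX.measurable 0 t).aemeasurable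
  have hne : ∀ᵐ ω ∂P, ∀ i i', i ≠ i' → X i ω t ≠ X i' ω t := by
    refine ae_all_iff.2 fun i => ae_all_iff.2 fun i' => ?_
    by_cases h : i = i'
    · exact ae_of_all _ fun ω hne => absurd h hne
    · have hno : NullSingletonClass (P.map fun ω => X i' ω t) := by
        rw [hid]
        exact noAtoms_of_continuous_cdf _ hcont
      filter_upwards [ae_ne_of_indepFun (hX.measurable i t) (hX.measurable i' t)
        ((hX.indep.indepFun h).comp (φ := fun y : T → ℝ => y t) (ψ := fun y : T → ℝ => y t)
          (measurable_pi_apply t) (measurable_pi_apply t)) hno] with ω hω _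
      exact hω
  filter_upwards [hne] with ω hω i i' heq
  by_contra h
  exact hω i i' h heq

/-! ### Weak convergence on a finite space, and the main limit -/

theorem integral_map_eq_sum {Ω E : Type*} [MeasurableSpace Ω] [MeasurableSpace E] [Fintype E]
    [DiscreteMeasurableSpace E] {P : Measure Ω} [IsProbabilityMeasure P] {F : Ω → E}
    (hF : Measurable F) (f : E → ℝ) :
    ∫ x, f x ∂(P.map F) = ∑ x, P.real {ω | F ω = x} * f x := by
  have := Measure.isProbabilityMeasure_map (μ := P) hF.aemeasurable
  rw [integral_fintype Integrable.of_finite]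
  refine Finset.sum_congr rfl fun x _ => ?_
  rw [measureReal_def, Measure.map_apply hF .of_discrete]
  rfl

theorem tendstoInDistribution_of_tendsto_measureReal {Ω Ω' E : Type*} [MeasurableSpace Ω]
    [MeasurableSpace Ω'] [MeasurableSpace E] [TopologicalSpace E] [Fintype E]
    [DiscreteMeasurableSpace E] [OpensMeasurableSpace E] {P : Measure Ω} {P' : Measure Ω'}
    [IsProbabilityMeasure P] [IsProbabilityMeasure P'] {F : ℕ → Ω → E} {G : Ω' → E}
    (hF : ∀ n, Measurable (F n)) (hG : Measurable G)
    (h : ∀ x, Tendsto (fun n => P.real {ω | F n ω = x}) atTop (𝓝 (P'.real {ω | G ω = x}))) :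
    TendstoInDistribution F atTop G (fun _ => P) P' where
  forall_aemeasurable n := (hF n).aemeasurable
  aemeasurable_limit := hG.aemeasurable
  tendsto := by
    refine ProbabilityMeasure.tendsto_iff_forall_integral_tendsto.2 fun f => ?_
    change Tendsto (fun n => ∫ x, f x ∂(P.map (F n))) atTop (𝓝 (∫ x, f x ∂(P'.map G)))
    rw [integral_map_eq_sum hG f]
    simp only [fun n => integral_map_eq_sum (P := P) (hF n) f]
    exact tendsto_finsetSum _ fun x _ => (h x).mul_const _

theorem IndepCopies.isIIDArray {Ω T : Type*} [MeasurableSpace Ω] {P : Measure Ω}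
    {X : ℕ → Ω → T → ℝ} (hX : IndepCopies X P) {k : ℕ} (s : Fin k → T)
    {g : ℕ → Fin k → ℝ → ℝ} (hg : ∀ n j, Measurable (g n j)) :
    IsIIDArray (fun n i ω j => g n j (X i ω (s j))) P := by
  have hm : ∀ n, Measurable fun (y : T → ℝ) (j : Fin k) => g n j (y (s j)) := fun n =>
    measurable_pi_lambda _ fun j => (hg n j).comp (measurable_pi_apply (s j))
  exact
    { measurable := fun n i => measurable_pi_lambda _ fun j => (hg n j).comp (hX.measurable i (s j))
      iIndep := fun n => hX.indep.comp (fun _ y j => g n j (y (s j))) fun _ => hm n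
      identDistrib := fun n i => (hX.identDistrib i).comp (hm n) }

/-- A function that is strictly increasing on a set carrying the margin may be replaced by a
measurable one. -/
theorem IndepCopies.exists_measurable_ae_eq {Ω T : Type*} [MeasurableSpace Ω] {P : Measure Ω}
    {X : ℕ → Ω → T → ℝ} (hX : IndepCopies X P) (t : T) {D : Set ℝ} (hD : MeasurableSet D)
    (hXD : ∀ᵐ ω ∂P, X 0 ω t ∈ D) {h : ℝ → ℝ} (hh : StrictMonoOn h D) :
    ∃ g : ℝ → ℝ, Measurable g ∧ ∀ᵐ ω ∂P, ∀ i, X i ω t ∈ D ∧ h (X i ω t) = g (X i ω t) := by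
  set μ := P.map fun ω => X 0 ω t with hμ
  have hid : ∀ i, P.map (fun ω => X i ω t) = μ := fun i =>
    ((hX.identDistrib i).comp (u := fun y : T → ℝ => y t) (measurable_pi_apply t)).map_eq
  have hDμ : ∀ᵐ x ∂μ, x ∈ D := (ae_map_iff (hX.measurable 0 t).aemeasurable hD).2 hXD
  have hh' : AEMeasurable h μ := by
    have := aemeasurable_restrict_of_monotoneOn (μ := μ) hD hh.monotoneOn
    rwa [Measure.restrict_eq_self_of_ae_mem hDμ] at this
  refine ⟨hh'.mk h, hh'.measurable_mk, ae_all_iff.2 fun i => ?_⟩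
  have h1 : ∀ᵐ x ∂(P.map fun ω => X i ω t), x ∈ D ∧ h x = hh'.mk h x := by
    rw [hid]
    exact hDμ.and hh'.ae_eq_mk
  exact ae_of_ae_map (hX.measurable i t).aemeasurable h1

theorem ciSup_sub_div_le_iff {ι : Type*} [Finite ι] [Nonempty ι] {u : ι → ℝ} {a b x : ℝ}
    (ha : 0 < a) : ((⨆ i, u i) - b) / a ≤ x ↔ ∀ i, (u i - b) / a ≤ x := by
  simp only [div_le_iff₀ ha, tsub_le_iff_right]
  exact ciSup_le_iff (Set.finite_range u).bddAbove

/-- The array is built from measurable versions `g` of `h`. These agree with `h` at all observations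
almost surely, so the normalized maxima are those of the array and the argmax sets are those of `X`.
-/
theorem tendsto_measureReal_sampleScenario {T : Type*} [TopologicalSpace T] {k : ℕ}
    (s : Fin k → T)
    {Ω : Type*} [MeasurableSpace Ω] {P : Measure Ω} [IsProbabilityMeasure P]
    {X : ℕ → Ω → T → ℝ} (hX : IndepCopies X P)
    {Ω' : Type*} [MeasurableSpace Ω'] {P' : Measure Ω'} [IsProbabilityMeasure P']
    {ζ : ℕ → Ω' → ℝ} {Y : ℕ → Ω' → T → ℝ} (hη : IsSpectralRepresentation ζ Y P')
    {D : Fin k → Set ℝ} (hD : ∀ j, MeasurableSet (D j))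
    (hXD : ∀ j, ∀ᵐ ω ∂P, X 0 ω (s j) ∈ D j)
    {h : Fin k → ℝ → ℝ} (hh : ∀ j, StrictMonoOn (h j) (D j))
    (hMDA : InMaxDomainOfAttraction (fun i ω j => h j (X i ω (s j))) P
      (fun ω j => maxStable ζ Y ω (s j)) P') (τ : Partitions k) :
    Tendsto (fun n => P.real {ω | sampleScenario X s n ω = τ}) atTop
      (𝓝 (P'.real {ω | extremalScenario ζ Y s ω = τ})) := by
  obtain ⟨a, b, ha, hM⟩ := hMDA
  choose g hg hgX using fun j => hX.exists_measurable_ae_eq (s j) (hD j) (hXD j) (hh j)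
  have hgX' := ae_all_iff.2 hgX
  set W : ℕ → ℕ → Ω → Fin k → ℝ := fun n i ω j => (g j (X i ω (s j)) - b n j) / a n j with hWdef
  set V : ℕ → Ω' → Fin k → ℝ := fun i ω j => Y i ω (s j)
  have hW : IsIIDArray W P := hX.isIIDArray s (g := fun n j x => (g j x - b n j) / a n j)
    fun n j => ((hg j).sub_const _).div_const _
  have hV : IsSpectralVector ζ V P' := hη.isSpectralVector s
  have hMW : ∀ n, 1 ≤ n → ∀ᵐ ω ∂P, ∀ j x,
      (sampleMax (fun i ω j => h j (X i ω (s j))) n ω j - b n j) / a n j ≤ x ↔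
        ∀ i : Fin n, W n i ω j ≤ x := fun n hn => by
    filter_upwards [hgX'] with ω hω j x
    have : Nonempty (Fin n) := ⟨⟨0, hn⟩⟩
    simp only [hWdef, ← (hω j _).2]
    exact ciSup_sub_div_le_iff (ha n j)
  have hext : ∀ ω, extremalScenario ζ Y s ω =
      hittingScenario fun i : ℕ => ζ i ω • V i ω := fun ω => rfl
  have hM' : TendstoInDistribution
      (fun n ω j => (sampleMax (fun i ω j => h j (X i ω (s j))) n ω j - b n j) / a n j) atTop
      (fun ω j => ⨆ i, (ζ i ω • V i ω) j) (fun _ => P) P' := hM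
  have key := tendsto_measureReal_hittingScenario hV hW (fun L ρ hρ c =>
    tendsto_measureReal_forall_gridCell_le hV hM' hMW hρ c) τ
  simp only [hext]
  refine key.congr fun n => ?_
  rw [measureReal_def, measureReal_def]
  congr 1
  refine measure_congr ?_
  filter_upwards [hgX'] with ω hω
  have heq : hittingScenario (fun (i : Fin n) j => (g j (X i ω (s j)) - b n j) / a n j) =
      sampleScenario X s n ω := by
    refine hittingScenario_congr fun j₁ j₂ => ?_
    have harg : ∀ j, (argMax fun i : Fin n => (g j (X i ω (s j)) - b n j) / a n j) =
        argMax fun i : Fin n => X i ω (s j) := fun j => argMax_congr fun i i' => by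
      rw [div_le_div_iff_of_pos_right (ha n j), sub_le_sub_iff_right, ← (hω j i).2,
        ← (hω j i').2]
      exact (hh j).le_iff_le (hω j i).1 (hω j i').1
    rw [harg, harg]
  exact congrArg (fun σ => σ = τ) heq

theorem measureReal_forall_mem_part {Ω : Type*} [MeasurableSpace Ω] {P : Measure Ω}
    [IsProbabilityMeasure P] {k : ℕ} {F : Ω → Partitions k} (hF : Measurable F)
    [DecidablePred fun τ : Partitions k => ∀ j₁ j₂, j₂ ∈ τ.part j₁] :
    P.real {ω | ∀ j₁ j₂, j₂ ∈ (F ω).part j₁} =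
      ∑ τ : Partitions k with ∀ j₁ j₂, j₂ ∈ τ.part j₁, P.real {ω | F ω = τ} := by
  rw [← measureReal_mem_finset _ (fun τ _ => hF (MeasurableSet.of_discrete (s := {τ})))
    (fun _ _ => measure_ne_top _ _)]
  simp

end Concurrence

theorem theorem1 {d : ℕ} {𝒳 : Set (EuclideanSpace ℝ (Fin d))} (h𝒳 : IsCompact 𝒳)
    {k : ℕ} (s : Fin k → 𝒳)
    -- the observations: independent copies of a process on `𝒳` with continuous margins
    {Ω : Type*} [MeasurableSpace Ω] (P : Measure Ω) [IsProbabilityMeasure P]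
    (X : ℕ → Ω → 𝒳 → ℝ) (hX : IndepCopies X P)
    (hX_cont : ∀ t : 𝒳, Continuous (cdf (P.map fun ω => X 0 ω t)))
    -- the max-stable process
    {Ω' : Type*} [MeasurableSpace Ω'] (P' : Measure Ω') [IsProbabilityMeasure P']
    (ζ : ℕ → Ω' → ℝ) (Y : ℕ → Ω' → 𝒳 → ℝ) (hη : IsSpectralRepresentation ζ Y P')
    -- marginal transformations, each strictly increasing on a set that carries the margin
    (D : Fin k → Set ℝ) (hD : ∀ j, MeasurableSet (D j))
    (hXD : ∀ j, ∀ᵐ ω ∂P, X 0 ω (s j) ∈ D j)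
    (h : Fin k → ℝ → ℝ) (hh : ∀ j, StrictMonoOn (h j) (D j))
    (hMDA : InMaxDomainOfAttraction (fun i ω j => h j (X i ω (s j))) P
      (fun ω j => maxStable ζ Y ω (s j)) P') :
    -- almost surely, `π_n` consists of the nonempty sets among `C_1, …, C_n`
    (∀ n, 1 ≤ n → ∀ᵐ ω ∂P, ∀ C : Finset (Fin k), C ∈ (sampleScenario X s n ω).parts ↔
      C.Nonempty ∧ ∃ i : Fin n, (C : Set (Fin k)) = dominatedSet X s n ω i) ∧
    -- almost surely, the maxima that define `π` are attained at exactly one point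
    (∀ᵐ ω ∂P', ∀ j, ∃! i : ℕ, maxStable ζ Y ω (s j) = spectralPoint ζ Y i ω (s j)) ∧
    -- weak convergence of the hitting scenarios
    TendstoInDistribution (fun n => sampleScenario X s n) atTop (extremalScenario ζ Y s)
      (fun _ => P) P' ∧
    -- convergence of the concurrence probabilities
    Tendsto (fun n => sampleConcurrenceProb X P s n) atTop
      (𝓝 (extremalConcurrenceProb ζ Y P' s)) := by
  classical
  have hinj : ∀ᵐ ω ∂P, ∀ j, Function.Injective fun i => X i ω (s j) :=
    ae_all_iff.2 fun j => hX.ae_injective (s j) (hX_cont (s j))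
  have hV := hη.isSpectralVector s
  have hmax := hV.ae_exists_strict_max
  have hsample : ∀ n, 1 ≤ n → ∀ᵐ ω ∂P, (∀ j, ∃ i, (argMax fun i : Fin n => X i ω (s j)) = {i}) :=
    fun n hn => by
      filter_upwards [hinj] with ω hω j
      have : Nonempty (Fin n) := ⟨⟨0, hn⟩⟩
      exact exists_argMax_eq_singleton ((hω j).comp Fin.val_injective)
  have hmem : ∀ n ω (i : Fin n) j, sampleMax X n ω (s j) = X i ω (s j) ↔
      i ∈ argMax fun i : Fin n => X i ω (s j) := fun n ω i j =>
    ciSup_eq_iff_mem_argMax (u := fun i : Fin n => X i ω (s j)) (Set.finite_range _).bddAbove i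
  have hlim : ∀ᵐ ω ∂P', ∀ j, (∃ i, (argMax fun i => spectralPoint ζ Y i ω (s j)) = {i}) ∧
      ∀ i, maxStable ζ Y ω (s j) = spectralPoint ζ Y i ω (s j) ↔
        i ∈ argMax fun i => spectralPoint ζ Y i ω (s j) := by
    filter_upwards [hmax] with ω hω j
    obtain ⟨i, hi⟩ := hω j
    exact ⟨⟨i, argMax_eq_singleton hi⟩, fun i' => ciSup_eq_iff_mem_argMax
      (u := fun i => spectralPoint ζ Y i ω (s j)) (bddAbove_range_of_strict_max hi) i'⟩
  have hFm : ∀ n, Measurable (sampleScenario X s n) := fun n =>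
    measurable_hittingScenario (ψ := fun (i : Fin n) ω j => X i ω (s j))
      fun i j => hX.measurable i (s j)
  have hGm : Measurable (extremalScenario ζ Y s) :=
    measurable_hittingScenario (ψ := fun i ω j => spectralPoint ζ Y i ω (s j))
      fun i j => (hη.poisson.measurable i).mul (hη.copies.measurable i (s j))
  have hconv := tendsto_measureReal_sampleScenario s hX hη hD hXD hh hMDA
  refine ⟨fun n hn => ?_, ?_, tendstoInDistribution_of_tendsto_measureReal hFm hGm hconv, ?_⟩
  · filter_upwards [hsample n hn] with ω hω C
    refine (mem_parts_hittingScenario_iff hω C).trans (and_congr_right fun _ =>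
      exists_congr fun i => ?_)
    simp only [dominatedSet, hmem]
  · filter_upwards [hlim] with ω hω j
    obtain ⟨⟨i, hi⟩, h2⟩ := hω j
    simp only [h2, hi]
    exact ⟨i, rfl, fun i' hi' => hi'⟩
  · have hp : extremalConcurrenceProb ζ Y P' s =
        P'.real {ω | ∀ j₁ j₂, j₂ ∈ (extremalScenario ζ Y s ω).part j₁} := by
      rw [extremalConcurrenceProb, measureReal_def, measureReal_def]
      congr 1
      refine measure_congr ?_
      filter_upwards [hlim] with ω hω
      refine propext ?_
      change (∃ l : ℕ, ∀ j, maxStable ζ Y ω (s j) = spectralPoint ζ Y l ω (s j)) ↔ _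
      simp only [fun j => (hω j).2]
      exact exists_mem_argMax_iff fun j => (hω j).1
    have hpn : ∀ n, 1 ≤ n → sampleConcurrenceProb X P s n =
        P.real {ω | ∀ j₁ j₂, j₂ ∈ (sampleScenario X s n ω).part j₁} := fun n hn => by
      rw [sampleConcurrenceProb, measureReal_def, measureReal_def]
      congr 1
      refine measure_congr ?_
      filter_upwards [hsample n hn] with ω hω
      refine propext ?_
      change (∃ l : Fin n, ∀ j, sampleMax X n ω (s j) = X l ω (s j)) ↔ _
      have : Nonempty (Fin n) := ⟨⟨0, hn⟩⟩
      simp only [hmem]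
      exact exists_mem_argMax_iff hω
    -- Both concurrence probabilities are sums over the finitely many partitions with all sites in
    -- one block, so convergence is termwise.
    rw [hp, measureReal_forall_mem_part hGm]
    refine (tendsto_finsetSum _ fun τ _ => hconv τ).congr' ?_
    filter_upwards [eventually_ge_atTop 1] with n hn
    rw [hpn n hn, measureReal_forall_mem_part (hFm n)]
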